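/- **Setting.** Let $S$ be a nonempty finite set, $N=|S|$, and let $\Xi_F=(S,\mathbf 1,\mathrm{wt})$ be a full passport, that is, a function $\mathrm{wt}:S\to\mathbb R\setminus\{0\}$ with $\sum_{s\in S}\mathrm{wt}(s)=0$ (so $N\ge 2$); put $|\Xi_F|=N$. *Trees.* A tree of passport $\Xi_F$ is a plane tree with vertex set $S$, given up to orientation-preserving homeomorphism by an abstract tree together with a cyclic (anticlockwise) order of the edges around each vertex, whose vertices are colored black or white so that each edge joins a black and a white vertex, and whose edges carry positive real weights such that, for every $v\in S$, the sum of the weights of the edges at $v$ equals $\mathrm{wt}(v)$ if $v$ is black and $-\mathrm{wt}(v)$ if $v$ is white. $\mathrm{Tree}(\Xi_F)$ is the set of all these trees (vertices are distinguished by their labels in $S$). $\mathbf TR(\Xi_F)$ is the set of rooted trees $(T;a,b)$, where $T\in\mathrm{Tree}(\Xi_F)$ and $a$, $b$ are the black and the white vertex of an edge of $T$. *Permutations.* For an ordering $\underline P=(s_1,\dots,s_N)$ of $S$ let $H_i=\sum_{j\le i}\mathrm{wt}(s_j)$, $0\le i\le N$, so $H_0=H_N=0$. It is a *positive tree permutation*,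 $\underline P\in\mathbf PT_+(\Xi_F)$, if $H_i>0$ for all $1\le i\le N-1$ and it is a *tree permutation*, i.e. 1. $H_i\ne0$ for all $1\le i\le N-1$; 2. if $H_{k-1}=H_l>0$ with $1\le k<l\le N$, then $\min\{H_k,\dots,H_{l-1}\}<H_l$; 3. if $H_{k-1}=H_l<0$ with $1\le k<l\le N$, then $\max\{H_k,\dots,H_{l-1}\}>H_l$. *Combing map.* Let $R(\underline P)\subset\mathbb R^2$ be the union of the rectangles $[i,i+1]\times[\min\{0,H_i\},\max\{0,H_i\}]$, $1\le i\le N$. Its $i$-th vertical line is $\{i\}\times[\min\{H_{i-1},H_i\},\max\{H_{i-1},H_i\}]$ and its $i$-th horizontal line is $[i,i+1]\times\{H_i\}$. Extend every horizontal line within $R(\underline P)$ maximally in both directions; these segments and the segment $[1,N]\times\{0\}$ cut $R(\underline P)$ into horizontal rectangles, each bounded on the left and on the right by two vertical lines. Let $G(\underline P)$ be the graph on $S$, with $s$ black if $\mathrm{wt}(s)>0$ and white otherwise, having for each horizontal rectangle bounded by the $k$-th and the $l$-th vertical lines an edge $s_ks_l$ whose weight is the height of the rectangle; the anticlockwise cyclic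 order of the edges at $s_i$ lists the rectangles attached to the right of the $i$-th vertical line from bottom to top, then those attached to its left from top to bottom. The combing map is $\mathrm{Comb}(\underline P)=(G(\underline P);s_1,s_N)$. **Proposition 3.3.** The combing map restricts to a bijection $$\mathrm{Comb}:\ \mathbf PT_+(\Xi_F)\longrightarrow\mathbf TR(\Xi_F).$$ Therefore $\mathrm{Tree}(\Xi_F)$ is finite and $$|\mathbf PT_+(\Xi_F)|=(|\Xi_F|-1)\cdot|\mathrm{Tree}(\Xi_F)|.$$ -/

import Mathlib

noncomputable section

/-- A full passport on a finite index set `S` (every multiplicity equal to one): nonzero real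
weights of total sum zero. -/
structure FullPassport (S : Type*) [Fintype S] where
  wt : S → ℝ
  wt_ne_zero : ∀ s, wt s ≠ 0
  sum_wt : ∑ s, wt s = 0

/-- A weighted bi-colored ribbon graph with vertex set `S`. In a full passport the labeling of the
vertices is a bijection onto the index set, so vertices are identified with their labels, and two
labeled graphs are isomorphic exactly when they are equal as elements of this type.

* `black` is the set of black vertices, its complement the set of white vertices;
* `weight` is the weight function on edges, extended by zero to the non-edges;
* `rot v` is the cyclic action at `v`: it sends an edge at `v` to the next edge at `v` in
  anticlockwise order. As the graph is simple, an edge at `v` is recorded by its other end, and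
  `rot v` is extended by the identity to the vertices that are not adjacent to `v`. -/
@[ext]
structure RibbonGraph (S : Type*) where
  graph : SimpleGraph S
  black : Set S
  weight : Sym2 S → ℝ
  rot : S → Equiv.Perm S
  weight_eq_zero : ∀ e, e ∉ graph.edgeSet → weight e = 0
  rot_isCycleOn : ∀ v, (rot v).IsCycleOn (graph.neighborSet v)
  rot_eq_self : ∀ v u, ¬ graph.Adj v u → rot v u = u

open Classical in
/-- The signed weight of a vertex: plus (black) or minus (white) the sum of the weights of the
edges at that vertex. -/
def RibbonGraph.vertexWeight {S : Type*} [Fintype S] (T : RibbonGraph S) (v : S) : ℝ :=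
  if v ∈ T.black then ∑ u, T.weight s(v, u) else - ∑ u, T.weight s(v, u)

namespace FullPassport

/-- `T` is a labeled weighted bi-colored plane tree of passport `Ξ`; the plane embedding, up to
orientation-preserving homeomorphism, is recorded by the cyclic actions. -/
structure IsPlaneTree {S : Type*} [Fintype S] (Ξ : FullPassport S) (T : RibbonGraph S) :
    Prop where
  isTree : T.graph.IsTree
  bicolored : ∀ u v, T.graph.Adj u v → (u ∈ T.black ↔ v ∉ T.black)
  weight_pos : ∀ e ∈ T.graph.edgeSet, 0 < T.weight e
  vertexWeight_eq : ∀ v, T.vertexWeight v = Ξ.wt v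

/-- The set of (isomorphism classes of) trees of passport `Ξ`. -/
def Tree {S : Type*} [Fintype S] (Ξ : FullPassport S) : Set (RibbonGraph S) :=
  {T | Ξ.IsPlaneTree T}

/-- Rooted trees `(T; a, b)`: `a` and `b` are the black and the white vertex of an edge of `T`. -/
def RootedTree {S : Type*} [Fintype S] (Ξ : FullPassport S) : Set (RibbonGraph S × S × S) :=
  {x | x.1 ∈ Ξ.Tree ∧ x.1.graph.Adj x.2.1 x.2.2 ∧ x.2.1 ∈ x.1.black ∧ x.2.2 ∉ x.1.black}

/-- Permutations `(s_1, …, s_N)` of the index set, `N = |S|`. The entry `s_i` is `P (i - 1)`. -/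
abbrev Permutation (S : Type*) [Fintype S] : Type _ := Fin (Fintype.card S) ≃ S

section Combing

variable {S : Type*} [Fintype S] (Ξ : FullPassport S) (P : Permutation S)

/-- The cumulative sum `H_i = wt s_1 + ⋯ + wt s_i`, for `0 ≤ i ≤ N`. -/
def cumSum (i : ℕ) : ℝ := ∑ j : Fin (Fintype.card S) with j.val < i, Ξ.wt (P j)

/-! The histogram region. Positions are numbered from `0`, so that the vertical line of
position `i` stands at abscissa `i` and joins the heights `cumSum i` and `cumSum (i + 1)`. -/

/-- The vertical rectangle (possibly a segment) of position `i`. -/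
def column (i : Fin (Fintype.card S)) : Set (ℝ × ℝ) :=
  Set.Icc (i : ℝ) ((i : ℝ) + 1) ×ˢ
    Set.Icc (min 0 (Ξ.cumSum P (i + 1))) (max 0 (Ξ.cumSum P (i + 1)))

/-- The region of the permutation. -/
def region : Set (ℝ × ℝ) := ⋃ i, Ξ.column P i

/-- The horizontal line of position `i`. -/
def hLine (i : Fin (Fintype.card S)) : Set (ℝ × ℝ) :=
  Set.Icc (i : ℝ) ((i : ℝ) + 1) ×ˢ {Ξ.cumSum P (i + 1)}

/-- The (rising or falling) vertical line of position `i`. -/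
def vLine (i : Fin (Fintype.card S)) : Set (ℝ × ℝ) :=
  {(i : ℝ)} ×ˢ Set.uIcc (Ξ.cumSum P i) (Ξ.cumSum P (i + 1))

/-- The horizontal line of position `i`, maximally extended in both directions inside the
region. -/
def extendedLine (i : Fin (Fintype.card S)) : Set (ℝ × ℝ) :=
  {p | ∃ q ∈ Ξ.hLine P i, p.2 = q.2 ∧ segment ℝ p q ⊆ Ξ.region P}

/-- The union of the horizontal cuts: the extended horizontal lines and the segment on the
x-axis. -/
def cuts : Set (ℝ × ℝ) :=
  (Set.Icc (0 : ℝ) ((Fintype.card S : ℝ) - 1) ×ˢ {(0 : ℝ)}) ∪ ⋃ i, Ξ.extendedLine P i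

/-- The horizontal rectangles into which the cuts split the region. Such a rectangle lies in the
region, its left and right sides lie on two vertical lines, its lower and upper sides lie on cuts,
and no cut enters its interior. -/
structure HorizontalRectangle where
  left : Fin (Fintype.card S)
  right : Fin (Fintype.card S)
  bottom : ℝ
  top : ℝ
  left_lt_right : left < right
  bottom_lt_top : bottom < top
  subset_region : Set.Icc (left : ℝ) (right : ℝ) ×ˢ Set.Icc bottom top ⊆ Ξ.region P
  left_side : {(left : ℝ)} ×ˢ Set.Icc bottom top ⊆ Ξ.vLine P left
  right_side : {(right : ℝ)} ×ˢ Set.Icc bottom top ⊆ Ξ.vLine P right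
  bottom_side : Set.Icc (left : ℝ) (right : ℝ) ×ˢ {bottom} ⊆ Ξ.cuts P
  top_side : Set.Icc (left : ℝ) (right : ℝ) ×ˢ {top} ⊆ Ξ.cuts P
  interior_disjoint :
    Disjoint (Set.Ioo (left : ℝ) (right : ℝ) ×ˢ Set.Ioo bottom top) (Ξ.cuts P)

/-- The edge created by a horizontal rectangle: it joins the vertices of the two vertical lines
that bound the rectangle. -/
def HorizontalRectangle.edge {Ξ : FullPassport S} {P : Permutation S}
    (r : Ξ.HorizontalRectangle P) : Sym2 S := s(P r.left, P r.right)

/-- The graph whose edges are the horizontal rectangles. -/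
def combGraph : SimpleGraph S :=
  SimpleGraph.fromEdgeSet (Set.range (HorizontalRectangle.edge (Ξ := Ξ) (P := P)))

open Classical in
/-- The weight of an edge is the height of its rectangle (an edge comes from only one rectangle);
non-edges get `0`. -/
def combWeight (e : Sym2 S) : ℝ :=
  if h : ∃ r : Ξ.HorizontalRectangle P, r.edge = e then h.choose.top - h.choose.bottom else 0

/-- Some horizontal rectangle has its left side on the vertical line of position `k` and its right
side on that of position `l`. -/
def Joined (k l : Fin (Fintype.card S)) : Prop :=
  ∃ r : Ξ.HorizontalRectangle P, r.left = k ∧ r.right = l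

open Classical in
/-- The height of the lower side of the rectangle between positions `k` and `l`. -/
def joinBottom (k l : Fin (Fintype.card S)) : ℝ :=
  if h : Ξ.Joined P k l then h.choose.bottom else 0

open Classical in
/-- The rectangles attached to the right of the vertical line of position `i`, from bottom to top
(each recorded by the position at its other end). -/
def rightList (i : Fin (Fintype.card S)) : List (Fin (Fintype.card S)) :=
  ((List.finRange _).filter (fun l => Ξ.Joined P i l)).insertionSort
    (fun l l' => Ξ.joinBottom P i l ≤ Ξ.joinBottom P i l')

open Classical in
/-- The rectangles attached to the left of the vertical line of position `i`, from top to bottom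
(each recorded by the position at its other end). -/
def leftList (i : Fin (Fintype.card S)) : List (Fin (Fintype.card S)) :=
  ((List.finRange _).filter (fun k => Ξ.Joined P k i)).insertionSort
    (fun k k' => Ξ.joinBottom P k' i ≤ Ξ.joinBottom P k i)

/-- The cyclic action at the vertex `v`: each edge goes to its successor in the list of the
rectangles on the right from bottom to top followed by those on the left from top to bottom, and
the last one goes to the first one. -/
def combRot (v : S) : Equiv.Perm S :=
  P.permCongr (Ξ.rightList P (P.symm v) ++ Ξ.leftList P (P.symm v)).formPerm

theorem Joined.lt {Ξ : FullPassport S} {P : Permutation S} {k l : Fin (Fintype.card S)}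
    (h : Ξ.Joined P k l) : k < l := by
  obtain ⟨r, rfl, rfl⟩ := h
  exact r.left_lt_right

theorem mem_rotList {i j : Fin (Fintype.card S)} :
    j ∈ Ξ.rightList P i ++ Ξ.leftList P i ↔ Ξ.Joined P i j ∨ Ξ.Joined P j i := by
  simp [rightList, leftList]

theorem nodup_rotList (i : Fin (Fintype.card S)) :
    (Ξ.rightList P i ++ Ξ.leftList P i).Nodup := by
  classical
  refine List.Nodup.append ?_ ?_ ?_
  · exact (List.perm_insertionSort _ _).nodup_iff.2 ((List.nodup_finRange _).filter _)
  · exact (List.perm_insertionSort _ _).nodup_iff.2 ((List.nodup_finRange _).filter _)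
  · intro j hj hj'
    have h1 : Ξ.Joined P i j := by simpa [rightList] using hj
    have h2 : Ξ.Joined P j i := by simpa [leftList] using hj'
    exact lt_asymm h1.lt h2.lt

theorem combGraph_adj {i j : Fin (Fintype.card S)} :
    (Ξ.combGraph P).Adj (P i) (P j) ↔ Ξ.Joined P i j ∨ Ξ.Joined P j i := by
  simp only [combGraph, SimpleGraph.fromEdgeSet_adj, Set.mem_range, HorizontalRectangle.edge,
    Joined, Sym2.eq_iff, P.injective.eq_iff, ne_eq]
  constructor
  · rintro ⟨⟨r, h | h⟩, -⟩
    · exact Or.inl ⟨r, h⟩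
    · exact Or.inr ⟨r, h⟩
  · rintro (⟨r, h⟩ | ⟨r, h⟩)
    · exact ⟨⟨r, Or.inl h⟩, fun e => r.left_lt_right.ne (by rw [h.1, h.2, e])⟩
    · exact ⟨⟨r, Or.inr h⟩, fun e => r.left_lt_right.ne (by rw [h.1, h.2, e])⟩

/-- The labeled weighted bi-colored ribbon graph of a permutation. -/
def combRibbon : RibbonGraph S where
  graph := Ξ.combGraph P
  black := {s | 0 < Ξ.wt s}
  weight := Ξ.combWeight P
  rot := Ξ.combRot P
  weight_eq_zero := by
    intro e he
    refine dif_neg ?_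
    rintro ⟨r, rfl⟩
    refine he ?_
    change (Ξ.combGraph P).Adj (P r.left) (P r.right)
    exact (Ξ.combGraph_adj P).2 (Or.inl ⟨r, rfl, rfl⟩)
  rot_isCycleOn := by
    intro v
    obtain ⟨i, rfl⟩ := P.surjective v
    have h := (Ξ.nodup_rotList P i).isCycleOn_formPerm
    have hs : (Ξ.combGraph P).neighborSet (P i) =
        P '' {j | j ∈ Ξ.rightList P i ++ Ξ.leftList P i} := by
      ext u
      obtain ⟨j, rfl⟩ := P.surjective u
      simp only [SimpleGraph.mem_neighborSet, combGraph_adj, mem_rotList,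
        P.injective.mem_set_image, Set.mem_ofPred_eq]
    rw [hs]
    simp only [combRot, Equiv.symm_apply_apply]
    refine ⟨⟨?_, (Equiv.injective _).injOn, ?_⟩, ?_⟩
    · rintro _ ⟨j, hj, rfl⟩
      exact ⟨_, h.1.mapsTo hj, by simp [Equiv.permCongr_apply]⟩
    · rintro _ ⟨j, hj, rfl⟩
      obtain ⟨k, hk, rfl⟩ := h.1.surjOn hj
      exact ⟨P k, ⟨k, hk, rfl⟩, by simp [Equiv.permCongr_apply]⟩
    · rintro _ ⟨j, hj, rfl⟩ _ ⟨k, hk, rfl⟩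
      obtain ⟨n, hn⟩ := h.2 hj hk
      refine ⟨n, ?_⟩
      rw [← hn]
      have := map_zpow P.permCongrHom (Ξ.rightList P i ++ Ξ.leftList P i).formPerm n
      change ((P.permCongrHom (Ξ.rightList P i ++ Ξ.leftList P i).formPerm) ^ n) (P j) = _
      rw [← this]
      simp [Equiv.permCongrHom, Equiv.permCongr_apply]
  rot_eq_self := by
    intro v u huv
    obtain ⟨i, rfl⟩ := P.surjective v
    obtain ⟨j, rfl⟩ := P.surjective u
    rw [combGraph_adj, ← mem_rotList] at huv
    simp [combRot, Equiv.permCongr_apply, List.formPerm_apply_of_notMem huv]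

/-- The combing map `P = (s_1, …, s_N) ↦ (G(P); s_1, s_N)`. -/
def comb [Nonempty S] (Ξ : FullPassport S) (P : Permutation S) : RibbonGraph S × S × S :=
  (Ξ.combRibbon P, P ⟨0, Fintype.card_pos⟩,
    P ⟨Fintype.card S - 1, Nat.sub_lt Fintype.card_pos Nat.one_pos⟩)

end Combing

/-- Positive permutations: `H_i > 0` for `1 ≤ i ≤ N - 1`. -/
def PositivePerm {S : Type*} [Fintype S] (Ξ : FullPassport S) : Set (Permutation S) :=
  {P | ∀ i, 1 ≤ i → i < Fintype.card S → 0 < Ξ.cumSum P i}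

/-- Tree permutations: `H_i ≠ 0` for `1 ≤ i ≤ N - 1`; if `H_a = H_l > 0` with `a + 1 < l ≤ N`, then
the minimum of `H_{a+1}, …, H_{l-1}` is smaller than this common value; and if `H_a = H_l < 0`,
then their maximum is larger than it. -/
def TreePerm {S : Type*} [Fintype S] (Ξ : FullPassport S) : Set (Permutation S) :=
  {P | (∀ i, 1 ≤ i → i < Fintype.card S → Ξ.cumSum P i ≠ 0) ∧
    (∀ a l, a + 1 < l → l ≤ Fintype.card S → Ξ.cumSum P a = Ξ.cumSum P l → 0 < Ξ.cumSum P l →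
      ∃ j, a < j ∧ j < l ∧ Ξ.cumSum P j < Ξ.cumSum P l) ∧
    (∀ a l, a + 1 < l → l ≤ Fintype.card S → Ξ.cumSum P a = Ξ.cumSum P l → Ξ.cumSum P l < 0 →
      ∃ j, a < j ∧ j < l ∧ Ξ.cumSum P l < Ξ.cumSum P j)}

/-- Positive tree permutations. -/
def PositiveTreePerm {S : Type*} [Fintype S] (Ξ : FullPassport S) : Set (Permutation S) :=
  Ξ.PositivePerm ∩ Ξ.TreePerm

end FullPassport

end

/-! For a positive permutation the geometry of combing depends only on the heights `H`. The vertical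
lines `k < l` bound a rectangle exactly when `H` exceeds both `H k` and `H (l + 1)` on `(k, l]`
(`Arc`). Its lower side is then at the larger of these two heights and its upper side at the minimum
of `H` on `(k, l]` (`joined_iff_arc`, `combWeight_eq_of_arc`).

Combing gives a tree of the right passport. The rectangles on one side of a vertical line fill it,
so their heights telescope to the weight (`sum_combWeight`). An arc is determined by the first
position of its minimum, which leaves at most N - 1 arcs (`card_arcs_le_card`). The tree condition
makes this minimum unique, and cutting arcs at their minima proves connectedness (`rel_of_arc`).

Conversely, let the vertices of a tree be ordered on a line so that the edges are noncrossing arcs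
whose left ends are black. Then `H n` is the total weight of the edges over the n-th gap, and
combing returns these edges with their weights (`IsPlaneTree.arc_and_height`). The N - 1 edges
already reach the maximal number of arcs. A violation of the tree condition would cost one arc, so
the ordering is a tree permutation (`IsPlaneTree.comb_eq`).

It remains to see that a rooted plane tree has exactly one such order that starts at `a`, ends at
`b` and is compatible with the rotations (`IsContourOrder`). For uniqueness, a comparison of two
vertices is pushed towards the root until the color or the rotation at one vertex decides it. For
existence, each vertex gets a rational position at a distance from its parent that shrinks
geometrically with the depth. The cardinality formula follows because a tree has N - 1 edges, each
giving one root. -/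

/-! ### Arcs and minima of a height function -/

/-- Positions `k < l` such that the values of `H` on `(k, l]` exceed both `H k` and `H (l + 1)`. -/
def Arc (H : ℕ → ℝ) (k l : ℕ) : Prop :=
  k < l ∧ ∀ m, k < m → m ≤ l → H k < H m ∧ H (l + 1) < H m

/-- The minimum of `H` on `(k, l]`. -/
noncomputable def low (H : ℕ → ℝ) (k l : ℕ) : ℝ := sInf (H '' Set.Ioc k l)

theorem low_le (H : ℕ → ℝ) {k l m : ℕ} (hk : k < m) (hl : m ≤ l) : low H k l ≤ H m :=
  csInf_le ((Set.finite_Ioc k l).image H).bddBelow ⟨m, ⟨hk, hl⟩, rfl⟩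

theorem exists_eq_low (H : ℕ → ℝ) {k l : ℕ} (h : k < l) :
    ∃ m, k < m ∧ m ≤ l ∧ H m = low H k l := by
  obtain ⟨m, ⟨hk, hl⟩, hm⟩ :=
    ((Set.nonempty_Ioc.2 h).image H).csInf_mem ((Set.finite_Ioc k l).image H)
  exact ⟨m, hk, hl, hm⟩

theorem lt_low_iff (H : ℕ → ℝ) {k l : ℕ} (h : k < l) {y : ℝ} :
    y < low H k l ↔ ∀ m, k < m → m ≤ l → y < H m := by
  constructor
  · intro hy m hk hl
    exact hy.trans_le (low_le H hk hl)
  · intro hy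
    obtain ⟨m, hk, hl, hm⟩ := exists_eq_low H h
    exact hm ▸ hy m hk hl

theorem arc_iff_lt_low {H : ℕ → ℝ} {k l : ℕ} (h : k < l) :
    Arc H k l ↔ max (H k) (H (l + 1)) < low H k l := by
  rw [lt_low_iff H h]
  simp only [Arc, h, true_and, max_lt_iff]

theorem mem_segment_of_mem_uIcc {x x' y t : ℝ} (ht : t ∈ Set.uIcc x x') :
    (t, y) ∈ segment ℝ (x, y) (x', y) := by
  rw [← Prod.image_mk_segment_left]
  exact ⟨t, by rwa [segment_eq_uIcc], rfl⟩

/-! ### Horizontal rectangles of a positive permutation are arcs -/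

namespace FullPassport

variable {S : Type*} [Fintype S] {Ξ : FullPassport S} {P : Permutation S}

theorem cumSum_zero (Ξ : FullPassport S) (P : Permutation S) : Ξ.cumSum P 0 = 0 := by
  simp [cumSum]

theorem cumSum_card (Ξ : FullPassport S) (P : Permutation S) :
    Ξ.cumSum P (Fintype.card S) = 0 := by
  rw [cumSum, Finset.filter_true_of_mem (fun j _ => j.isLt), ← Ξ.sum_wt]
  exact Equiv.sum_comp P Ξ.wt

theorem cumSum_succ (Ξ : FullPassport S) (P : Permutation S) (i : Fin (Fintype.card S)) :
    Ξ.cumSum P (i + 1) = Ξ.cumSum P i + Ξ.wt (P i) := by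
  have h : (Finset.univ.filter fun j : Fin (Fintype.card S) => j.val < i + 1) =
      insert i (Finset.univ.filter fun j : Fin (Fintype.card S) => j.val < i) := by
    ext j
    simp only [Finset.mem_filter, Finset.mem_univ, true_and, Finset.mem_insert, Fin.ext_iff]
    omega
  rw [cumSum, h, Finset.sum_insert (by simp), add_comm]
  rfl

theorem cumSum_nonneg (hP : P ∈ Ξ.PositivePerm) {i : ℕ} (hi : i ≤ Fintype.card S) :
    0 ≤ Ξ.cumSum P i := by
  rcases Nat.eq_zero_or_pos i with rfl | h
  · rw [cumSum_zero]
  rcases hi.eq_or_lt with rfl | h'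
  · rw [cumSum_card]
  · exact (hP i h h').le

theorem mem_region_iff (hP : P ∈ Ξ.PositivePerm) {x y : ℝ} :
    (x, y) ∈ Ξ.region P ↔ ∃ i : Fin (Fintype.card S), ((i : ℝ) ≤ x ∧ x ≤ i + 1) ∧
      0 ≤ y ∧ y ≤ Ξ.cumSum P (i + 1) := by
  simp only [region, column, Set.mem_iUnion, Set.mem_prod, Set.mem_Icc]
  refine exists_congr fun i => ?_
  have h := cumSum_nonneg hP (Nat.succ_le_of_lt i.isLt)
  rw [min_eq_left h, max_eq_right h]

/-- The abscissa `i + 1 / 2` meets no column but the `i`-th, whereas an integer abscissa lies on two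
neighboring columns. -/
theorem le_of_mem_region (hP : P ∈ Ξ.PositivePerm) {i : ℕ} {y : ℝ}
    (h : ((i : ℝ) + 1 / 2, y) ∈ Ξ.region P) : y ≤ Ξ.cumSum P (i + 1) := by
  obtain ⟨j, ⟨h1, h2⟩, -, h3⟩ := (mem_region_iff hP).1 h
  have h4 : ((j : ℕ) : ℝ) < ((i + 1 : ℕ) : ℝ) := by push_cast; linarith
  have h5 : (i : ℝ) < ((j + 1 : ℕ) : ℝ) := by push_cast; linarith
  have h6 : (j : ℕ) < i + 1 := by exact_mod_cast h4
  have h7 : i < j + 1 := by exact_mod_cast h5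
  have h8 : (j : ℕ) = i := by omega
  rwa [← h8]

theorem mem_region_of_forall_le (hP : P ∈ Ξ.PositivePerm) {k l : ℕ} (hl : l < Fintype.card S)
    (hkl : k < l) {x y : ℝ} (hkx : k ≤ x) (hxl : x ≤ l) (hy : 0 ≤ y)
    (h : ∀ m, k < m → m ≤ l → y ≤ Ξ.cumSum P m) : (x, y) ∈ Ξ.region P := by
  rw [mem_region_iff hP]
  rcases hxl.eq_or_lt with rfl | hxl
  -- At the right end the floor of `x` would select column `l`, whose height `H (l + 1)` is not
  -- controlled.
  · refine ⟨⟨l - 1, by omega⟩, ?_, hy, h _ ?_ ?_⟩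
    · have : ((l - 1 : ℕ) : ℝ) = l - 1 := by
        rw [Nat.cast_sub (by omega)]; simp
      simp [this]
    · change k < l - 1 + 1; omega
    · change l - 1 + 1 ≤ l; omega
  · have hx : 0 ≤ x := (Nat.cast_nonneg k).trans hkx
    have h1 : k ≤ ⌊x⌋₊ := Nat.le_floor hkx
    have h2 : ⌊x⌋₊ < l := (Nat.floor_lt hx).2 hxl
    exact ⟨⟨⌊x⌋₊, by omega⟩, ⟨Nat.floor_le hx, (Nat.lt_floor_add_one x).le⟩, hy,
      h _ (Nat.lt_succ_of_le h1) h2⟩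

/-- A cut at level `y` that comes from a column outside the strip would have to run through column
`k - 1` or column `l`. These have heights `H k` and `H (l + 1)`, both below `y`. -/
theorem exists_eq_of_mem_cuts (hP : P ∈ Ξ.PositivePerm) {k l : ℕ}
    {x y : ℝ} (hkx : k < x) (hxl : x < l) (hk : Ξ.cumSum P k < y) (hl : Ξ.cumSum P (l + 1) < y)
    (hy : 0 < y) (h : (x, y) ∈ Ξ.cuts P) : ∃ m, k < m ∧ m ≤ l ∧ Ξ.cumSum P m = y := by
  rcases h with h | h
  · exact absurd h.2 hy.ne'
  obtain ⟨i, q, ⟨⟨hq1, hq2⟩, hq3⟩, hq, hseg⟩ := Set.mem_iUnion.1 h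
  obtain ⟨q1, q2⟩ := q
  simp only [Set.mem_singleton_iff] at hq hq1 hq2 hq3
  subst hq
  by_contra! hne
  have hi := hne (i + 1)
  have key : (i : ℕ) + 1 < k ∨ l < (i : ℕ) := by
    rcases lt_trichotomy ((i : ℕ) + 1) k with h1 | h1 | h1
    · exact Or.inl h1
    · rw [hq3, h1] at hk
      exact absurd hk (lt_irrefl _)
    · rcases lt_trichotomy l (i : ℕ) with h2 | h2 | h2
      · exact Or.inr h2
      · rw [hq3, h2] at hl
        exact absurd hl (lt_irrefl _)
      · exact absurd hq3.symm (hi h1 h2)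
  rcases key with h1 | h1
  · obtain ⟨k, rfl⟩ : ∃ k', k = k' + 1 := ⟨k - 1, by omega⟩
    have h2 : ((i : ℕ) : ℝ) + 1 ≤ k := by exact_mod_cast (show (i : ℕ) + 1 ≤ k by omega)
    push_cast at hkx
    exact absurd (le_of_mem_region hP (hseg (mem_segment_of_mem_uIcc (t := (k : ℝ) + 1 / 2)
      (Set.mem_uIcc.2 (Or.inr ⟨by linarith, by linarith⟩))))) hk.not_ge
  · have h2 : (l : ℝ) + 1 ≤ (i : ℕ) := by exact_mod_cast (show l + 1 ≤ (i : ℕ) by omega)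
    exact absurd (le_of_mem_region hP (hseg (mem_segment_of_mem_uIcc (t := (l : ℝ) + 1 / 2)
      (Set.mem_uIcc.2 (Or.inl ⟨by linarith, by linarith⟩))))) hl.not_ge

theorem HorizontalRectangle.sides (hP : P ∈ Ξ.PositivePerm) (r : Ξ.HorizontalRectangle P) :
    max (Ξ.cumSum P r.left) (Ξ.cumSum P (r.right + 1)) ≤ r.bottom ∧
      r.top ≤ low (Ξ.cumSum P) r.left r.right := by
  have hbt := r.bottom_lt_top
  have hlr : (r.left : ℕ) < r.right := r.left_lt_right
  have hlr' : ((r.left : ℕ) : ℝ) ≤ (r.right : ℕ) := by exact_mod_cast hlr.le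
  have htop : ∀ m, (r.left : ℕ) < m → m ≤ r.right → r.top ≤ Ξ.cumSum P m := by
    intro m h1 h2
    obtain ⟨m, rfl⟩ : ∃ m', m = m' + 1 := ⟨m - 1, by omega⟩
    have h1' : ((r.left : ℕ) : ℝ) ≤ m := by exact_mod_cast Nat.lt_succ_iff.1 h1
    have h2' : (m : ℝ) + 1 ≤ (r.right : ℕ) := by exact_mod_cast h2
    exact le_of_mem_region hP (r.subset_region ⟨⟨by simp only; linarith, by simp only; linarith⟩,
      ⟨hbt.le, le_rfl⟩⟩)
  have hleft : ∀ y ∈ Set.Icc r.bottom r.top,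
      y ∈ Set.uIcc (Ξ.cumSum P r.left) (Ξ.cumSum P (r.left + 1)) := fun y hy =>
    (r.left_side (Set.mk_mem_prod rfl hy)).2
  have hright : ∀ y ∈ Set.Icc r.bottom r.top,
      y ∈ Set.uIcc (Ξ.cumSum P r.right) (Ξ.cumSum P (r.right + 1)) := fun y hy =>
    (r.right_side (Set.mk_mem_prod rfl hy)).2
  have h1 := htop (r.left + 1) (Nat.lt_succ_self _) hlr
  have h2 := htop r.right hlr le_rfl
  have h3 := Set.mem_uIcc.1 (hleft _ ⟨le_rfl, hbt.le⟩)
  have h4 := Set.mem_uIcc.1 (hright _ ⟨le_rfl, hbt.le⟩)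
  refine ⟨max_le ?_ ?_, ?_⟩
  · rcases h3 with h3 | h3
    · exact h3.1
    · linarith
  · rcases h4 with h4 | h4
    · linarith
    · exact h4.1
  · obtain ⟨m, hm1, hm2, hm⟩ := exists_eq_low (Ξ.cumSum P) hlr
    exact hm ▸ htop m hm1 hm2

theorem HorizontalRectangle.arc (hP : P ∈ Ξ.PositivePerm) (r : Ξ.HorizontalRectangle P) :
    Arc (Ξ.cumSum P) r.left r.right := by
  have h := r.sides hP
  exact (arc_iff_lt_low r.left_lt_right).2 (h.1.trans_lt (r.bottom_lt_top.trans_le h.2))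

theorem HorizontalRectangle.mid_mem_cuts {Ξ : FullPassport S} {P : Permutation S}
    (r : Ξ.HorizontalRectangle P) {y : ℝ} (h : y = r.bottom ∨ y = r.top) :
    ((r.left : ℝ) + 1 / 2, y) ∈ Ξ.cuts P := by
  have hlr : (r.left : ℕ) < r.right := r.left_lt_right
  have hlr' : ((r.left : ℕ) : ℝ) + 1 ≤ (r.right : ℕ) := by exact_mod_cast hlr
  rcases h with rfl | rfl
  · exact r.bottom_side ⟨⟨by simp, by simp only; linarith⟩, rfl⟩
  · exact r.top_side ⟨⟨by simp, by simp only; linarith⟩, rfl⟩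

/-- A lower side strictly above both outer heights would lie on a cut at some level `H m` with `m`
in `(k, l]`, hence not below the upper side. -/
theorem HorizontalRectangle.bottom_eq (hP : P ∈ Ξ.PositivePerm) (r : Ξ.HorizontalRectangle P) :
    r.bottom = max (Ξ.cumSum P r.left) (Ξ.cumSum P (r.right + 1)) := by
  obtain ⟨h1, h2⟩ := r.sides hP
  have hlr : (r.left : ℕ) < r.right := r.left_lt_right
  have hlr' : ((r.left : ℕ) : ℝ) + 1 ≤ (r.right : ℕ) := by exact_mod_cast hlr
  refine le_antisymm (le_of_not_gt fun h => ?_) h1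
  obtain ⟨h3, h4⟩ := max_lt_iff.1 h
  obtain ⟨m, hm1, hm2, hm⟩ := exists_eq_of_mem_cuts hP (by linarith) (by linarith) h3 h4
    ((cumSum_nonneg hP r.left.isLt.le).trans_lt h3) (r.mid_mem_cuts (Or.inl rfl))
  have := low_le (Ξ.cumSum P) hm1 hm2
  linarith [r.bottom_lt_top]

theorem HorizontalRectangle.top_eq (hP : P ∈ Ξ.PositivePerm) (r : Ξ.HorizontalRectangle P) :
    r.top = low (Ξ.cumSum P) r.left r.right := by
  obtain ⟨h1, h2⟩ := r.sides hP
  have hlr : (r.left : ℕ) < r.right := r.left_lt_right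
  have hlr' : ((r.left : ℕ) : ℝ) + 1 ≤ (r.right : ℕ) := by exact_mod_cast hlr
  obtain ⟨h3, h4⟩ := max_lt_iff.1 (h1.trans_lt r.bottom_lt_top)
  obtain ⟨m, hm1, hm2, hm⟩ := exists_eq_of_mem_cuts hP (by linarith) (by linarith) h3 h4
    ((cumSum_nonneg hP r.left.isLt.le).trans_lt h3) (r.mid_mem_cuts (Or.inr rfl))
  exact h2.antisymm (hm ▸ low_le (Ξ.cumSum P) hm1 hm2)

theorem mem_cuts_of_mem_hLine (hP : P ∈ Ξ.PositivePerm) {k l : ℕ} (hl : l < Fintype.card S)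
    (hkl : k < l) {x y q : ℝ} (hkx : k ≤ x) (hxl : x ≤ l)
    (hkq : k ≤ q) (hql : q ≤ l) {i : Fin (Fintype.card S)}
    (hq : (q, y) ∈ Ξ.hLine P i)
    (h : ∀ m, k < m → m ≤ l → y ≤ Ξ.cumSum P m) : (x, y) ∈ Ξ.cuts P := by
  refine Or.inr (Set.mem_iUnion.2 ⟨i, (q, y), hq, rfl, ?_⟩)
  have hy : 0 ≤ y := by
    rw [show y = Ξ.cumSum P (i + 1) from hq.2]
    exact cumSum_nonneg hP (Nat.succ_le_of_lt i.isLt)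
  rw [← Prod.image_mk_segment_left, segment_eq_uIcc]
  rintro _ ⟨t, ht, rfl⟩
  exact mem_region_of_forall_le hP hl hkl ((le_inf hkx hkq).trans ht.1)
    (ht.2.trans (sup_le hxl hql)) hy h

/-- The rectangle is the largest one allowed by `HorizontalRectangle.sides`. A cut through its
interior would have a level `H m` below the minimum of `H` on `(k, l]`. -/
theorem joined_of_arc (hP : P ∈ Ξ.PositivePerm) {k l : Fin (Fintype.card S)}
    (h : Arc (Ξ.cumSum P) k l) : Ξ.Joined P k l := by
  have hkl : (k : ℕ) < l := h.1
  have hkl' : ((k : ℕ) : ℝ) + 1 ≤ (l : ℕ) := by exact_mod_cast hkl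
  have hbt := (arc_iff_lt_low hkl).1 h
  have hb : 0 ≤ max (Ξ.cumSum P k) (Ξ.cumSum P (l + 1)) :=
    (cumSum_nonneg hP k.isLt.le).trans (le_max_left _ _)
  have hlow : ∀ m, (k : ℕ) < m → m ≤ l → low (Ξ.cumSum P) k l ≤ Ξ.cumSum P m :=
    fun m => low_le _
  refine ⟨⟨k, l, max (Ξ.cumSum P k) (Ξ.cumSum P (l + 1)), low (Ξ.cumSum P) k l, hkl, hbt,
    ?_, ?_, ?_, ?_, ?_, ?_⟩, rfl, rfl⟩
  · rintro ⟨x, y⟩ ⟨⟨hx1, hx2⟩, hy1, hy2⟩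
    exact mem_region_of_forall_le hP l.isLt hkl hx1 hx2 (hb.trans hy1)
      fun m h1 h2 => hy2.trans (hlow m h1 h2)
  · rintro ⟨x, y⟩ ⟨hx, hy1, hy2⟩
    exact ⟨hx, Set.mem_uIcc.2 (Or.inl ⟨(le_max_left _ _).trans hy1,
      hy2.trans (hlow _ (Nat.lt_succ_self _) hkl)⟩)⟩
  · rintro ⟨x, y⟩ ⟨hx, hy1, hy2⟩
    exact ⟨hx, Set.mem_uIcc.2 (Or.inr ⟨(le_max_right _ _).trans hy1,
      hy2.trans (hlow _ hkl le_rfl)⟩)⟩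
  · rintro ⟨x, y⟩ ⟨⟨hx1, hx2⟩, hy⟩
    simp only [Set.mem_singleton_iff] at hy hx1 hx2
    have hle : ∀ m, (k : ℕ) < m → m ≤ l → y ≤ Ξ.cumSum P m :=
      fun m h1 h2 => hy.le.trans (hbt.le.trans (hlow m h1 h2))
    -- At level zero the lower side lies on the x-axis cut. Otherwise it extends the horizontal line
    -- of position `k - 1`, which ends at abscissa `k`, or that of position `l`, which starts at
    -- abscissa `l`.
    rcases (hb.trans_eq hy.symm).eq_or_lt with h0 | h0
    · refine Or.inl ⟨⟨(Nat.cast_nonneg _).trans hx1, hx2.trans ?_⟩, h0.symm⟩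
      have : ((l : ℕ) : ℝ) + 1 ≤ Fintype.card S := by exact_mod_cast l.isLt
      linarith
    rcases max_choice (Ξ.cumSum P k) (Ξ.cumSum P (l + 1)) with hc | hc
    · obtain ⟨k', hk'⟩ : ∃ k', (k : ℕ) = k' + 1 := by
        refine ⟨k - 1, (Nat.succ_pred_eq_of_ne_zero fun hk0 => ?_).symm⟩
        rw [hy, hc, hk0, cumSum_zero] at h0
        exact lt_irrefl _ h0
      refine mem_cuts_of_mem_hLine hP l.isLt hkl hx1 hx2 le_rfl (by linarith)
        (i := ⟨k', by omega⟩) ⟨?_, ?_⟩ hle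
      · rw [hk']; push_cast; exact ⟨by simp, le_rfl⟩
      · change y = Ξ.cumSum P (k' + 1)
        rw [hy, hc, hk']
    · exact mem_cuts_of_mem_hLine hP l.isLt hkl hx1 hx2 (by linarith) le_rfl
        (i := l) ⟨⟨le_rfl, by simp⟩, by rw [hy, hc]; rfl⟩ hle
  · rintro ⟨x, y⟩ ⟨⟨hx1, hx2⟩, hy⟩
    simp only [Set.mem_singleton_iff] at hy hx1 hx2
    have hle : ∀ m, (k : ℕ) < m → m ≤ l → y ≤ Ξ.cumSum P m :=
      fun m h1 h2 => hy.le.trans (hlow m h1 h2)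
    obtain ⟨m, hm1, hm2, hm⟩ := exists_eq_low (Ξ.cumSum P) hkl
    obtain ⟨m, rfl⟩ : ∃ m', m = m' + 1 := ⟨m - 1, by omega⟩
    have h1 : ((k : ℕ) : ℝ) ≤ m := by exact_mod_cast Nat.lt_succ_iff.1 hm1
    have h2 : (m : ℝ) + 1 ≤ (l : ℕ) := by exact_mod_cast hm2
    exact mem_cuts_of_mem_hLine hP l.isLt hkl hx1 hx2 h1 (by linarith)
      (i := ⟨m, by omega⟩) ⟨⟨le_rfl, by simp⟩, by rw [hy, ← hm]; rfl⟩ hle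
  · rw [Set.disjoint_left]
    rintro ⟨x, y⟩ ⟨⟨hx1, hx2⟩, hy1, hy2⟩ hc
    obtain ⟨h3, h4⟩ := max_lt_iff.1 hy1
    obtain ⟨m, hm1, hm2, hm⟩ := exists_eq_of_mem_cuts hP hx1 hx2 h3 h4 (hb.trans_lt hy1) hc
    exact absurd (hm ▸ hlow m hm1 hm2) (not_le.2 hy2)

theorem joined_iff_arc (hP : P ∈ Ξ.PositivePerm) {k l : Fin (Fintype.card S)} :
    Ξ.Joined P k l ↔ Arc (Ξ.cumSum P) k l := by
  refine ⟨?_, joined_of_arc hP⟩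
  rintro ⟨r, rfl, rfl⟩
  exact r.arc hP

theorem joinBottom_eq (hP : P ∈ Ξ.PositivePerm) {k l : Fin (Fintype.card S)}
    (h : Ξ.Joined P k l) :
    Ξ.joinBottom P k l = max (Ξ.cumSum P k) (Ξ.cumSum P (l + 1)) := by
  rw [joinBottom, dif_pos h, h.choose.bottom_eq hP, h.choose_spec.1, h.choose_spec.2]

theorem combWeight_eq_of_arc (hP : P ∈ Ξ.PositivePerm) {k l : Fin (Fintype.card S)}
    (h : Arc (Ξ.cumSum P) k l) : Ξ.combWeight P s(P k, P l) =
      low (Ξ.cumSum P) k l - max (Ξ.cumSum P k) (Ξ.cumSum P (l + 1)) := by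
  have hr : ∃ r : Ξ.HorizontalRectangle P, r.edge = s(P k, P l) := by
    obtain ⟨r, rfl, rfl⟩ := joined_of_arc hP h
    exact ⟨r, rfl⟩
  have hkl : k < l := h.1
  rw [combWeight, dif_pos hr, hr.choose.bottom_eq hP, hr.choose.top_eq hP]
  have hlr := hr.choose.left_lt_right
  rcases Sym2.eq_iff.1 hr.choose_spec with ⟨h1, h2⟩ | ⟨h1, h2⟩
  · rw [P.injective h1, P.injective h2]
  · rw [P.injective h1, P.injective h2] at hlr
    exact absurd hlr hkl.not_gt

end FullPassport

/-! ### Crossings, heights and number of arcs -/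

/-- The first arc would force `H (l + 1) < H k'`, the second one `H k' < H (l + 1)`. -/
theorem Arc.not_crossing {H : ℕ → ℝ} {k l k' l' : ℕ} (h : Arc H k l) (h' : Arc H k' l')
    (h1 : k < k') (h2 : k' < l) (h3 : l < l') : False :=
  lt_asymm (h.2 k' h1 h2.le).2 (h'.2 (l + 1) (by omega) h3).1

theorem Arc.lt_succ {H : ℕ → ℝ} {k l : ℕ} (h : Arc H k l) : H k < H (k + 1) :=
  (h.2 _ (Nat.lt_succ_self k) h.1).1

theorem Arc.succ_lt {H : ℕ → ℝ} {k l : ℕ} (h : Arc H k l) : H (l + 1) < H l :=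
  (h.2 _ h.1 le_rfl).2

/-- The height of the rectangle between positions `k < l`, zero if there is none. -/
noncomputable def height (H : ℕ → ℝ) (k l : ℕ) : ℝ :=
  max 0 (low H k l - max (H k) (H (l + 1)))

theorem height_of_arc {H : ℕ → ℝ} {k l : ℕ} (h : Arc H k l) :
    height H k l = low H k l - max (H k) (H (l + 1)) :=
  max_eq_right (sub_nonneg.2 ((arc_iff_lt_low h.1).1 h).le)

theorem height_pos {H : ℕ → ℝ} {k l : ℕ} (h : Arc H k l) : 0 < height H k l := by
  rw [height_of_arc h]
  exact sub_pos.2 ((arc_iff_lt_low h.1).1 h)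

theorem height_of_not_arc {H : ℕ → ℝ} {k l : ℕ} (hkl : k < l) (h : ¬ Arc H k l) :
    height H k l = 0 := by
  rw [arc_iff_lt_low hkl, not_lt] at h
  exact max_eq_left (sub_nonpos.2 h)

theorem low_self_succ (H : ℕ → ℝ) (k : ℕ) : low H k (k + 1) = H (k + 1) := by
  have : Set.Ioc k (k + 1) = {k + 1} := by
    ext m
    simp only [Set.mem_Ioc, Set.mem_singleton_iff]
    omega
  rw [low, this, Set.image_singleton, csInf_singleton]

theorem low_succ_right (H : ℕ → ℝ) {k l : ℕ} (h : k < l) :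
    low H k (l + 1) = min (low H k l) (H (l + 1)) := by
  have : Set.Ioc k (l + 1) = insert (l + 1) (Set.Ioc k l) := by
    ext m
    simp only [Set.mem_Ioc, Set.mem_insert_iff]
    omega
  rw [low, this, Set.image_insert_eq, csInf_insert ((Set.finite_Ioc k l).image H).bddBelow
    ((Set.nonempty_Ioc.2 h).image H), min_comm]
  rfl

theorem low_eq_min_left (H : ℕ → ℝ) {k l : ℕ} (h : k + 1 < l) :
    low H k l = min (H (k + 1)) (low H (k + 1) l) := by
  have : Set.Ioc k l = insert (k + 1) (Set.Ioc (k + 1) l) := by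
    ext m
    simp only [Set.mem_Ioc, Set.mem_insert_iff]
    omega
  rw [low, this, Set.image_insert_eq, csInf_insert ((Set.finite_Ioc _ l).image H).bddBelow
    ((Set.nonempty_Ioc.2 h).image H)]
  rfl

/-- This is one telescoping step: if `M` is the minimum over an interval and `c` the next height,
`min M c` is the minimum over the enlarged interval. -/
theorem max_zero_sub_max (M a c : ℝ) :
    max 0 (M - max a c) = max a M - max a (min M c) := by
  rcases le_total a c with h1 | h1 <;> rcases le_total M c with h2 | h2 <;>
    rcases le_total a M with h3 | h3 <;>
    simp only [max_eq_left, max_eq_right, min_eq_left, min_eq_right, h1, h2, h3]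
  all_goals
    first
      | (rw [max_eq_left] <;> linarith)
      | (rw [max_eq_right] <;> linarith)

/-- The rectangles to the right of line `k` fill it from the top down. After those with right end
before `n`, the part between `H k` and `low H k n` remains, and it is empty once `H` has returned to
`H k` or below. -/
theorem sum_height_right (H : ℕ → ℝ) {k n : ℕ} (hkn : k < n) (hk : H k ≤ H (k + 1))
    (hn : H n ≤ H k) : ∑ l ∈ Finset.Ico (k + 1) n, height H k l = H (k + 1) - H k := by
  have key : ∀ n, k + 1 ≤ n → ∑ l ∈ Finset.Ico (k + 1) n, height H k l =
      max (H k) (H (k + 1)) - max (H k) (low H k n) := by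
    intro n hn
    induction n, hn using Nat.le_induction with
    | base => simp [low_self_succ]
    | succ n hn ih =>
      rw [Finset.sum_Ico_succ_top hn, ih, low_succ_right H hn, height, max_zero_sub_max]
      ring
  rw [key n hkn, max_eq_right hk, max_eq_left ((low_le H hkn le_rfl).trans hn)]

/-- Mirror image of `sum_height_right`. The filling stops at the latest at position 0, and `min (low
H 0 l) (H 0)` is the minimum with this last height included. -/
theorem sum_height_left (H : ℕ → ℝ) {l : ℕ} (h0 : 0 < l) (hl : H (l + 1) ≤ H l)
    (hl0 : H 0 ≤ H (l + 1)) : ∑ k ∈ Finset.range l, height H k l = H l - H (l + 1) := by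
  have key : ∀ j, j < l → ∑ k ∈ Finset.range (j + 1), height H k l =
      max (H (l + 1)) (low H j l) - max (H (l + 1)) (min (low H 0 l) (H 0)) := by
    intro j hj
    induction j with
    | zero => rw [Finset.sum_range_one, height, max_comm (H 0), max_zero_sub_max]
    | succ j ih =>
      rw [Finset.sum_range_succ, ih (by omega), low_eq_min_left H hj, height,
        max_comm (H (j + 1)), max_zero_sub_max, min_comm (H (j + 1))]
      ring
  obtain ⟨j, rfl⟩ : ∃ j, l = j + 1 := ⟨l - 1, by omega⟩
  rw [key j (Nat.lt_succ_self j), low_self_succ, max_eq_right hl,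
    max_eq_left ((min_le_right _ _).trans hl0)]

/-- By `ht` the minimum of `H` on `(k, l]` is attained at a single position `i`. Hence `(k, i - 1)`
and `(i, l)` are shorter arcs or single positions. By induction each is one class, and the arc `(k,
l)` itself links the two. -/
theorem rel_of_arc {H : ℕ → ℝ} {N : ℕ}
    (ht : ∀ a l, 0 < a → a < l → l < N → H a = H l → ∃ j, a < j ∧ j < l ∧ H j < H l)
    {R : ℕ → ℕ → Prop} (hR : Equivalence R) (hA : ∀ k l, Arc H k l → l < N → R k l)
    {k l : ℕ} (h : Arc H k l) (hl : l < N) {m : ℕ} (hkm : k ≤ m) (hml : m ≤ l) : R k m := by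
  induction hn : l - k using Nat.strong_induction_on generalizing k l m with
  | _ n ih =>
  subst hn
  obtain ⟨i, hki, hil, hi⟩ := exists_eq_low H h.1
  have hmin : ∀ j, k < j → j ≤ l → j ≠ i → H i < H j := by
    intro j hkj hjl hji
    refine lt_of_le_of_ne (hi ▸ low_le H hkj hjl) fun he => ?_
    rcases hji.lt_or_gt with hlt | hlt
    · obtain ⟨x, h1, h2, h3⟩ := ht j i (by omega) hlt (by omega) he.symm
      exact absurd (hi ▸ low_le H (by omega : k < x) (by omega : x ≤ l)) (not_le.2 h3)
    · obtain ⟨x, h1, h2, h3⟩ := ht i j (by omega) hlt (by omega) he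
      rw [← he] at h3
      exact absurd (hi ▸ low_le H (by omega : k < x) (by omega : x ≤ l)) (not_le.2 h3)
  have hleft : ∀ m, k ≤ m → m < i → R k m := by
    intro m h1 h2
    rcases h1.eq_or_lt with rfl | h1
    · exact hR.refl _
    have harc : Arc H k (i - 1) := by
      refine ⟨by omega, fun j h3 h4 => ⟨(h.2 j h3 (by omega)).1, ?_⟩⟩
      rw [Nat.sub_add_cancel (by omega)]
      exact hmin j h3 (by omega) (by omega)
    exact ih (i - 1 - k) (by omega) harc (by omega) h1.le (by omega) rfl
  have hright : ∀ m, i ≤ m → m ≤ l → R i m := by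
    intro m h1 h2
    rcases h1.eq_or_lt with rfl | h1
    · exact hR.refl _
    have harc : Arc H i l := by
      refine ⟨by omega, fun j h3 h4 => ⟨hmin j (by omega) h4 (by omega), ?_⟩⟩
      exact (h.2 j (by omega) h4).2
    exact ih (l - i) (by omega) harc hl h1.le h2 rfl
  rcases lt_or_ge m i with h1 | h1
  · exact hleft m hkm h1
  · exact hR.trans (hR.trans (hA k l h hl) (hR.symm (hright l hil le_rfl))) (hright m h1 hml)

theorem exists_first_low (H : ℕ → ℝ) {k l : ℕ} (h : k < l) :
    ∃ m, k < m ∧ m ≤ l ∧ H m = low H k l ∧ ∀ j, k < j → j < m → H m < H j := by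
  classical
  have hex := exists_eq_low H h
  obtain ⟨h1, h2, h3⟩ := Nat.find_spec hex
  refine ⟨Nat.find hex, h1, h2, h3, fun j hj hj' => ?_⟩
  rw [h3]
  refine lt_of_le_of_ne (low_le H hj (by omega)) fun he => Nat.find_min hex hj' ⟨hj, by omega, ?_⟩
  exact he.symm

/-- Mapping an arc to the first position `m` of its minimum is injective: the ends are found by
going from `m` to the nearest lower heights on both sides. The set `M` is left free so that
positions can be excluded. -/
theorem card_arcs_le_card {H : ℕ → ℝ} (E : Finset (ℕ × ℕ)) (hE : ∀ e ∈ E, Arc H e.1 e.2)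
    (M : Finset ℕ) (hM : ∀ e ∈ E, ∀ m, e.1 < m → m ≤ e.2 → H m = low H e.1 e.2 →
      (∀ j, e.1 < j → j < m → H m < H j) → m ∈ M) : E.card ≤ M.card := by
  classical
  choose! f hf using fun (e : ℕ × ℕ) (he : e ∈ E) => exists_first_low H (hE e he).1
  refine Finset.card_le_card_of_injOn f (fun e he => hM e he _ (hf e he).1 (hf e he).2.1
    (hf e he).2.2.1 (hf e he).2.2.2) ?_
  have key : ∀ e ∈ E, ∀ e' ∈ E, f e = f e' → ¬ e.1 < e'.1 ∧ ¬ e.2 < e'.2 := by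
    intro e he e' he' hee
    obtain ⟨h1, h2, h3, -⟩ := hf e he
    obtain ⟨h1', h2', h3', -⟩ := hf e' he'
    rw [← hee] at h1' h2' h3'
    refine ⟨fun hlt => ?_, fun hlt => ?_⟩
    · have h4 := low_le H hlt (h1'.le.trans h2)
      have h5 := ((hE e' he').2 _ h1' h2').1
      linarith
    · have h4 := low_le H (show e'.1 < e.2 + 1 by omega) hlt
      have h5 := ((hE e he).2 _ h1 h2).2
      linarith
  intro e he e' he' hee
  have a := key e he e' he' hee
  have b := key e' he' e he hee.symm
  exact Prod.ext (by omega) (by omega)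

theorem card_arcs_lt {H : ℕ → ℝ} {N : ℕ} (E : Finset (ℕ × ℕ))
    (hE : ∀ e ∈ E, Arc H e.1 e.2 ∧ e.2 < N) (hN : 0 < N) : E.card < N := by
  have := card_arcs_le_card E (fun e he => (hE e he).1) (Finset.Ico 1 N)
    fun e he m h1 h2 _ _ => Finset.mem_Ico.2 ⟨by omega, h2.trans_lt (hE e he).2⟩
  rw [Nat.card_Ico] at this
  omega

/-- The position `l` is not the first minimum of any arc. Such an arc would start below `H l`, hence
to the left of `a`, and would meet the same height earlier, at `a`. -/
theorem card_arcs_add_one_lt {H : ℕ → ℝ} {N : ℕ} (E : Finset (ℕ × ℕ))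
    (hE : ∀ e ∈ E, Arc H e.1 e.2 ∧ e.2 < N) {a l : ℕ} (hal : a < l) (hl : l < N)
    (h : H a = H l) (hal' : ∀ j, a < j → j < l → H l ≤ H j) : E.card + 1 < N := by
  have := card_arcs_le_card E (fun e he => (hE e he).1) ((Finset.Ico 1 N).erase l) ?_
  · rw [Finset.card_erase_of_mem (Finset.mem_Ico.2 ⟨by omega, hl⟩), Nat.card_Ico] at this
    omega
  · intro e he m h1 h2 h3 h4
    refine Finset.mem_erase.2 ⟨?_, Finset.mem_Ico.2 ⟨by omega, h2.trans_lt (hE e he).2⟩⟩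
    rintro rfl
    have hlt := ((hE e he).1.2 m h1 h2).1
    have h5 : e.1 < a := by
      by_contra! h6
      rcases h6.eq_or_lt with h6 | h6
      · rw [← h6, h] at hlt
        exact lt_irrefl _ hlt
      · exact absurd (hal' _ h6 h1) (not_le.2 hlt)
    exact absurd h (h4 a h5 hal).ne'

/-! ### Rotations and decreasing lists of neighbors -/

namespace RibbonGraph

variable {S : Type*}

/-- The number of edges at the vertex `u`. -/
noncomputable def deg (T : RibbonGraph S) (u : S) : ℕ := (T.graph.neighborSet u).ncard

theorem adj_rot_pow (T : RibbonGraph S) {u r : S} (h : T.graph.Adj u r) (n : ℕ) :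
    T.graph.Adj u ((T.rot u ^ n) r) :=
  (T.rot_isCycleOn u).1.mapsTo.perm_pow n h

/-- For every vertex `u`, the rotation at `u` runs through the neighbors of `u` in decreasing
order of `f`, starting from the largest one. -/
def RotDesc {α : Type*} [Preorder α] (T : RibbonGraph S) (f : S → α) : Prop :=
  ∀ u r, T.graph.Adj u r → (∀ z, T.graph.Adj u z → f z ≤ f r) →
    ∀ n m, n < m → m < T.deg u → f ((T.rot u ^ m) r) < f ((T.rot u ^ n) r)

variable [Fintype S]

theorem exists_finset_neighborSet (T : RibbonGraph S) (u : S) :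
    ∃ A : Finset S, (A : Set S) = T.graph.neighborSet u ∧ A.card = T.deg u ∧
      (T.rot u).IsCycleOn A := by
  have h : ((Set.toFinite (T.graph.neighborSet u)).toFinset : Set S) = T.graph.neighborSet u :=
    Set.Finite.coe_toFinset _
  exact ⟨_, h, (Set.ncard_eq_toFinset_card _).symm, h.symm ▸ T.rot_isCycleOn u⟩

theorem rot_pow_deg (T : RibbonGraph S) {u r : S} (h : T.graph.Adj u r) :
    (T.rot u ^ T.deg u) r = r := by
  obtain ⟨A, hA, hc, hcyc⟩ := T.exists_finset_neighborSet u
  rw [← hc]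
  exact hcyc.pow_card_apply (by rw [← Finset.mem_coe, hA]; exact h)

theorem exists_rot_pow_eq (T : RibbonGraph S) {u r z : S} (h : T.graph.Adj u r)
    (hz : T.graph.Adj u z) : ∃ n < T.deg u, (T.rot u ^ n) r = z := by
  obtain ⟨A, hA, hc, hcyc⟩ := T.exists_finset_neighborSet u
  rw [← hc]
  exact hcyc.exists_pow_eq (by rw [← Finset.mem_coe, hA]; exact h)
    (by rw [← Finset.mem_coe, hA]; exact hz)

theorem rot_pow_injOn (T : RibbonGraph S) {u r : S} (h : T.graph.Adj u r) {n m : ℕ}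
    (hn : n < T.deg u) (hm : m < T.deg u) (he : (T.rot u ^ n) r = (T.rot u ^ m) r) : n = m := by
  obtain ⟨A, hA, hc, hcyc⟩ := T.exists_finset_neighborSet u
  rw [← hc] at hn hm
  exact ((hcyc.pow_apply_eq_pow_apply (by rw [← Finset.mem_coe, hA]; exact h)).1 he).eq_of_lt_of_lt
    hn hm

theorem deg_pos (T : RibbonGraph S) {u r : S} (h : T.graph.Adj u r) : 0 < T.deg u :=
  (Set.ncard_pos).2 ⟨r, h⟩

theorem deg_le (T : RibbonGraph S) (u : S) : T.deg u ≤ Fintype.card S := by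
  rw [← Nat.card_eq_fintype_card]
  exact Set.ncard_le_card _

theorem exists_max_adj {α : Type*} [LinearOrder α] (T : RibbonGraph S) (f : S → α) {u z : S}
    (h : T.graph.Adj u z) : ∃ r, T.graph.Adj u r ∧ ∀ z, T.graph.Adj u z → f z ≤ f r := by
  obtain ⟨r, hr, hmax⟩ := Set.exists_max_image (T.graph.neighborSet u) f (Set.toFinite _) ⟨z, h⟩
  exact ⟨r, hr, hmax⟩

theorem range_rot_pow (T : RibbonGraph S) {u r : S} (h : T.graph.Adj u r) :
    Set.range (fun n : Fin (T.deg u) => (T.rot u ^ (n : ℕ)) r) = T.graph.neighborSet u := by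
  ext z
  constructor
  · rintro ⟨n, rfl⟩
    exact T.adj_rot_pow h n
  · intro hz
    obtain ⟨n, hn, rfl⟩ := T.exists_rot_pow_eq h hz
    exact ⟨⟨n, hn⟩, rfl⟩

/-- The rotations are determined by the graph and by the order of the vertices. -/
theorem RotDesc.rot_eq {α : Type*} [LinearOrder α] {T T' : RibbonGraph S} {f : S → α}
    (hf : f.Injective) (hT : T.RotDesc f) (hT' : T'.RotDesc f) (hg : T.graph = T'.graph) :
    T.rot = T'.rot := by
  have hdeg : ∀ u, T'.deg u = T.deg u := fun u => by rw [deg, deg, hg]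
  funext u
  ext z
  by_cases hz : T.graph.Adj u z
  swap
  · rw [T.rot_eq_self u z hz, T'.rot_eq_self u z (hg ▸ hz)]
  obtain ⟨r, hr, hmax⟩ := T.exists_max_adj f hz
  have hr' : T'.graph.Adj u r := hg ▸ hr
  have key : (fun n : Fin (T.deg u) => f ((T.rot u ^ (n : ℕ)) r)) =
      fun n : Fin (T.deg u) => f ((T'.rot u ^ (n : ℕ)) r) := by
    have h1 : StrictAnti fun n : Fin (T.deg u) => f ((T.rot u ^ (n : ℕ)) r) :=
      fun n m h => hT u r hr hmax n m h m.isLt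
    have h2 : StrictAnti fun n : Fin (T.deg u) => f ((T'.rot u ^ (n : ℕ)) r) :=
      fun n m h => hT' u r hr' (hg ▸ hmax) n m h ((hdeg u).symm ▸ m.isLt)
    -- Both sequences enumerate the same set of values in strictly decreasing order.
    refine (StrictAnti.range_inj h1 h2).1 ?_
    change Set.range (f ∘ fun n : Fin (T.deg u) => (T.rot u ^ (n : ℕ)) r) =
      Set.range (f ∘ fun n : Fin (T.deg u) => (T'.rot u ^ (n : ℕ)) r)
    have h2 := T'.range_rot_pow hr'
    rw [hdeg] at h2
    rw [Set.range_comp, Set.range_comp, T.range_rot_pow hr, h2, hg]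
  -- The bound includes `T.deg u`, where both rotations return to `r`; this gives the successor of
  -- the last neighbor.
  have hpow : ∀ n ≤ T.deg u, (T.rot u ^ n) r = (T'.rot u ^ n) r := by
    intro n hn
    rcases hn.eq_or_lt with rfl | hn
    · rw [T.rot_pow_deg hr, ← hdeg, T'.rot_pow_deg hr']
    · exact hf (congrFun key ⟨n, hn⟩)
  obtain ⟨n, hn, rfl⟩ := T.exists_rot_pow_eq hr hz
  have h1 := hpow (n + 1) hn
  rw [pow_succ', pow_succ', Equiv.Perm.mul_apply, Equiv.Perm.mul_apply] at h1
  rw [h1, hpow n hn.le]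

end RibbonGraph

/-! ### Combing a positive tree permutation gives a rooted tree -/

namespace FullPassport

variable {S : Type*} [Fintype S] {Ξ : FullPassport S} {P : Permutation S}

theorem combGraph_adj_iff_arc (hP : P ∈ Ξ.PositivePerm) {i j : Fin (Fintype.card S)} :
    (Ξ.combGraph P).Adj (P i) (P j) ↔ Arc (Ξ.cumSum P) i j ∨ Arc (Ξ.cumSum P) j i := by
  rw [combGraph_adj, joined_iff_arc hP, joined_iff_arc hP]

theorem wt_pos_of_arc {i : Fin (Fintype.card S)} {j : ℕ} (h : Arc (Ξ.cumSum P) i j) :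
    0 < Ξ.wt (P i) := by
  have h1 := h.lt_succ
  rw [cumSum_succ] at h1
  linarith

theorem wt_neg_of_arc {i : ℕ} {j : Fin (Fintype.card S)} (h : Arc (Ξ.cumSum P) i j) :
    Ξ.wt (P j) < 0 := by
  have h1 := h.succ_lt
  rw [cumSum_succ] at h1
  linarith

theorem combWeight_of_lt (hP : P ∈ Ξ.PositivePerm) {i j : Fin (Fintype.card S)} (hij : i < j) :
    Ξ.combWeight P s(P i, P j) = height (Ξ.cumSum P) i j := by
  by_cases h : Arc (Ξ.cumSum P) i j
  · rw [combWeight_eq_of_arc hP h, height_of_arc h]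
  · rw [height_of_not_arc hij h]
    refine (Ξ.combRibbon P).weight_eq_zero _ fun he => ?_
    have he : (Ξ.combGraph P).Adj (P i) (P j) := he
    rcases (combGraph_adj_iff_arc hP).1 he with h' | h'
    · exact h h'
    · exact lt_asymm hij h'.1

/-- A rising line has rectangles only on its right and a falling line only on its left, so one of
the two telescoping sums accounts for all edges at the vertex. -/
theorem sum_combWeight (hP : P ∈ Ξ.PositivePerm) (i : Fin (Fintype.card S)) :
    ∑ u, Ξ.combWeight P s(P i, u) = |Ξ.wt (P i)| := by
  rw [← Equiv.sum_comp P]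
  have hzero : ∀ j, ¬ (Ξ.combGraph P).Adj (P i) (P j) → Ξ.combWeight P s(P i, P j) = 0 :=
    fun j hj => (Ξ.combRibbon P).weight_eq_zero _ hj
  rcases (Ξ.wt_ne_zero (P i)).lt_or_gt with h | h
  · have h1 : ∀ j, Ξ.combWeight P s(P i, P j) =
        if (j : ℕ) < i then height (Ξ.cumSum P) j i else 0 := by
      intro j
      split_ifs with hj
      · rw [Sym2.eq_swap, combWeight_of_lt hP hj]
      · refine hzero j fun ha => ?_
        rcases (combGraph_adj_iff_arc hP).1 ha with ha | ha
        · exact lt_asymm h (wt_pos_of_arc ha)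
        · exact hj ha.1
    rw [Finset.sum_congr rfl fun j _ => h1 j,
      Fin.sum_univ_eq_sum_range (fun j => if j < (i : ℕ) then height (Ξ.cumSum P) j i else 0),
      ← Finset.sum_filter]
    have h2 : (Finset.range (Fintype.card S)).filter (· < (i : ℕ)) = Finset.range i := by
      ext j
      simp only [Finset.mem_filter, Finset.mem_range]
      have := i.isLt
      omega
    have hs := cumSum_succ Ξ P i
    have h3 := cumSum_nonneg hP (Nat.succ_le_of_lt i.isLt)
    rw [h2, sum_height_left, abs_of_neg h, hs]
    · ring
    · rw [Nat.pos_iff_ne_zero]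
      intro h0
      rw [h0, cumSum_zero] at hs
      simp only [Nat.succ_eq_add_one, h0] at h3
      linarith
    · linarith
    · rw [cumSum_zero]
      exact h3
  · have h1 : ∀ j, Ξ.combWeight P s(P i, P j) =
        if (i : ℕ) < j then height (Ξ.cumSum P) i j else 0 := by
      intro j
      split_ifs with hj
      · rw [combWeight_of_lt hP hj]
      · refine hzero j fun ha => ?_
        rcases (combGraph_adj_iff_arc hP).1 ha with ha | ha
        · exact hj ha.1
        · exact lt_asymm h (wt_neg_of_arc ha)
    rw [Finset.sum_congr rfl fun j _ => h1 j,
      Fin.sum_univ_eq_sum_range (fun j => if (i : ℕ) < j then height (Ξ.cumSum P) i j else 0),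
      ← Finset.sum_filter]
    have h2 : (Finset.range (Fintype.card S)).filter ((i : ℕ) < ·) =
        Finset.Ico ((i : ℕ) + 1) (Fintype.card S) := by
      ext j
      simp only [Finset.mem_filter, Finset.mem_range, Finset.mem_Ico]
      omega
    have hs := cumSum_succ Ξ P i
    rw [h2, sum_height_right _ i.isLt, abs_of_pos h, hs]
    · ring
    · linarith
    · rw [cumSum_card]
      exact cumSum_nonneg hP i.isLt.le

/-- Transfers the bounds on numbers of arcs to numbers of edges. The inequality suffices, since the
opposite one always comes from a tree or from connectedness. -/
theorem card_edgeSet_le (hP : P ∈ Ξ.PositivePerm) : ∃ E : Finset (ℕ × ℕ),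
    (∀ e ∈ E, Arc (Ξ.cumSum P) e.1 e.2 ∧ e.2 < Fintype.card S) ∧
      (Ξ.combGraph P).edgeSet.ncard ≤ E.card := by
  classical
  let F : Finset (Fin (Fintype.card S) × Fin (Fintype.card S)) :=
    Finset.univ.filter fun e => Arc (Ξ.cumSum P) e.1 e.2
  refine ⟨F.map ⟨Prod.map Fin.val Fin.val, ?_⟩, ?_, ?_⟩
  · exact Fin.val_injective.prodMap Fin.val_injective
  · intro e he
    obtain ⟨⟨k, l⟩, h, rfl⟩ := Finset.mem_map.1 he
    exact ⟨(Finset.mem_filter.1 h).2, l.isLt⟩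
  · rw [Finset.card_map]
    refine (Set.ncard_le_ncard (t := (F.image fun e => s(P e.1, P e.2) : Finset (Sym2 S)))
      ?_ (Finset.finite_toSet _)).trans ?_
    · rintro e he
      induction e with | _ u v
      obtain ⟨i, rfl⟩ := P.surjective u
      obtain ⟨j, rfl⟩ := P.surjective v
      rw [Finset.coe_image]
      rcases (combGraph_adj_iff_arc hP).1 he with h | h
      · exact ⟨(i, j), Finset.mem_coe.2 (Finset.mem_filter.2 ⟨Finset.mem_univ _, h⟩), rfl⟩
      · exact ⟨(j, i), Finset.mem_coe.2 (Finset.mem_filter.2 ⟨Finset.mem_univ _, h⟩),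
          Sym2.eq_swap⟩
    · rw [Set.ncard_coe_finset]
      exact Finset.card_image_le

theorem two_le_card [Nonempty S] (Ξ : FullPassport S) : 2 ≤ Fintype.card S := by
  by_contra! h
  have h1 : Fintype.card S = 1 := by have := Fintype.card_pos (α := S); omega
  obtain ⟨s, hs⟩ := Fintype.card_eq_one_iff.1 h1
  have h2 := Ξ.sum_wt
  rw [Finset.sum_eq_single s (fun t _ ht => absurd (hs t) ht) (by simp)] at h2
  exact Ξ.wt_ne_zero s h2

theorem arc_zero_last [Nonempty S] (hP : P ∈ Ξ.PositivePerm) :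
    Arc (Ξ.cumSum P) 0 (Fintype.card S - 1) := by
  have := Ξ.two_le_card
  refine ⟨by omega, fun m h1 h2 => ?_⟩
  rw [Nat.sub_add_cancel (by omega), cumSum_zero, cumSum_card]
  exact ⟨hP m h1 (by omega), hP m h1 (by omega)⟩

theorem connected_combGraph [Nonempty S] (hP : P ∈ Ξ.PositiveTreePerm) :
    (Ξ.combGraph P).Connected := by
  classical
  have hN := Ξ.two_le_card
  let g : ℕ → S := fun i => if h : i < Fintype.card S then P ⟨i, h⟩ else P ⟨0, by omega⟩
  have hg : ∀ i : Fin (Fintype.card S), g i = P i := fun i => dif_pos i.isLt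
  have hr := (Ξ.combGraph P).reachable_is_equivalence
  have key : ∀ m, m ≤ Fintype.card S - 1 → (Ξ.combGraph P).Reachable (g 0) (g m) := by
    intro m hm
    refine rel_of_arc (N := Fintype.card S) (R := fun i j => (Ξ.combGraph P).Reachable (g i) (g j))
      ?_ ⟨fun _ => hr.refl _, hr.symm, hr.trans⟩ ?_ (arc_zero_last hP.1) (by omega)
      (Nat.zero_le m) hm
    · intro a l ha hal hl he
      -- Consecutive heights differ by a nonzero weight; the tree condition only concerns the other
      -- pairs.
      rcases (Nat.succ_le_of_lt hal).eq_or_lt with rfl | hal'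
      · exfalso
        have := cumSum_succ Ξ P ⟨a, by omega⟩
        simp only [Nat.succ_eq_add_one] at he this
        exact Ξ.wt_ne_zero (P ⟨a, by omega⟩) (by linarith)
      · exact hP.2.2.1 a l hal' hl.le he (hP.1 l (by omega) hl)
    · intro k l h hl
      have hk : k < Fintype.card S := h.1.trans hl
      have h3 : (Ξ.combGraph P).Adj (P ⟨k, hk⟩) (P ⟨l, hl⟩) :=
        (combGraph_adj_iff_arc hP.1).2 (Or.inl h)
      rw [← hg, ← hg] at h3
      exact h3.reachable
  have key' : ∀ v, (Ξ.combGraph P).Reachable (g 0) v := by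
    intro v
    obtain ⟨i, rfl⟩ := P.surjective v
    rw [← hg]
    exact key i (by omega)
  exact ⟨fun u v => (key' u).symm.trans (key' v)⟩

theorem isTree_combGraph [Nonempty S] (hP : P ∈ Ξ.PositiveTreePerm) :
    (Ξ.combGraph P).IsTree := by
  rw [SimpleGraph.isTree_iff_connected_and_card]
  have hc := connected_combGraph hP
  refine ⟨hc, le_antisymm ?_ hc.card_vert_le_card_edgeSet_add_one⟩
  obtain ⟨E, hE, hcard⟩ := card_edgeSet_le hP.1
  have := card_arcs_lt E hE Fintype.card_pos
  rw [Nat.card_coe_set_eq, Nat.card_eq_fintype_card]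
  omega

theorem comb_mem_rootedTree [Nonempty S] (hP : P ∈ Ξ.PositiveTreePerm) :
    Ξ.comb P ∈ Ξ.RootedTree := by
  classical
  have harc := arc_zero_last hP.1
  have hbl : ∀ i j, Arc (Ξ.cumSum P) (i : Fin (Fintype.card S)) (j : Fin (Fintype.card S)) →
      P i ∈ (Ξ.combRibbon P).black ∧ P j ∉ (Ξ.combRibbon P).black := fun i j h =>
    ⟨wt_pos_of_arc h, not_lt.2 (wt_neg_of_arc h).le⟩
  refine ⟨⟨isTree_combGraph hP, ?_, ?_, ?_⟩, ?_, ?_, ?_⟩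
  · intro u v huv
    obtain ⟨i, rfl⟩ := P.surjective u
    obtain ⟨j, rfl⟩ := P.surjective v
    rcases (combGraph_adj_iff_arc hP.1).1 huv with h | h
    · exact iff_of_true (hbl _ _ h).1 (hbl _ _ h).2
    · exact iff_of_false (hbl _ _ h).2 (not_not.2 (hbl _ _ h).1)
  · intro e he
    induction e with | _ u v
    obtain ⟨i, rfl⟩ := P.surjective u
    obtain ⟨j, rfl⟩ := P.surjective v
    change 0 < Ξ.combWeight P s(P i, P j)
    rcases (combGraph_adj_iff_arc hP.1).1 he with h | h
    · rw [combWeight_of_lt hP.1 h.1]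
      exact height_pos h
    · rw [Sym2.eq_swap, combWeight_of_lt hP.1 h.1]
      exact height_pos h
  · intro v
    obtain ⟨i, rfl⟩ := P.surjective v
    have h : ∑ u, (Ξ.combRibbon P).weight s(P i, u) = |Ξ.wt (P i)| := sum_combWeight hP.1 i
    change RibbonGraph.vertexWeight (Ξ.combRibbon P) (P i) = _
    rw [RibbonGraph.vertexWeight, h]
    split_ifs with hb
    · exact abs_of_pos hb
    · rw [abs_of_nonpos (not_lt.1 hb), neg_neg]
  · exact (combGraph_adj_iff_arc hP.1).2 (Or.inl harc)
  · exact wt_pos_of_arc (i := ⟨0, Fintype.card_pos⟩) harc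
  · exact not_lt.2 (wt_neg_of_arc (j := ⟨Fintype.card S - 1, _⟩) harc).le

/-- Of two arcs that leave `i` to the right, the longer one covers `l + 1` for the shorter end `l`,
so its lower side is strictly below that of the shorter one. The left side is symmetric, and ends on
the right come after ends on the left. -/
theorem pairwise_rotList (hP : P ∈ Ξ.PositivePerm) (i : Fin (Fintype.card S)) :
    (Ξ.rightList P i ++ Ξ.leftList P i).Pairwise (· > ·) := by
  classical
  have hnd := Ξ.nodup_rotList P i
  rw [List.nodup_append] at hnd
  rw [List.pairwise_append]
  refine ⟨?_, ?_, ?_⟩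
  · have : Std.Total (fun l l' => Ξ.joinBottom P i l ≤ Ξ.joinBottom P i l') :=
      ⟨fun _ _ => le_total _ _⟩
    have : IsTrans _ (fun l l' => Ξ.joinBottom P i l ≤ Ξ.joinBottom P i l') :=
      ⟨fun _ _ _ => le_trans⟩
    have hs : (Ξ.rightList P i).Pairwise (fun l l' => Ξ.joinBottom P i l ≤ Ξ.joinBottom P i l') :=
      List.pairwise_insertionSort _ _
    refine (hs.and hnd.1).imp_of_mem ?_
    rintro l l' hl hl' ⟨hle, hne⟩
    have h1 : Ξ.Joined P i l := by simpa [rightList] using hl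
    have h2 : Ξ.Joined P i l' := by simpa [rightList] using hl'
    refine lt_of_le_of_ne (le_of_not_gt fun hlt => ?_) hne.symm
    rw [joinBottom_eq hP h1, joinBottom_eq hP h2] at hle
    rw [joined_iff_arc hP] at h1 h2
    have h3 := h2.2 (l + 1) (by have := h1.1; omega) hlt
    have h4 := (le_max_right _ _).trans hle
    exact absurd (max_lt h3.1 h3.2) (not_lt.2 h4)
  · have : Std.Total (fun k k' => Ξ.joinBottom P k' i ≤ Ξ.joinBottom P k i) :=
      ⟨fun _ _ => le_total _ _⟩
    have : IsTrans _ (fun k k' => Ξ.joinBottom P k' i ≤ Ξ.joinBottom P k i) :=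
      ⟨fun _ _ _ h h' => h'.trans h⟩
    have hs : (Ξ.leftList P i).Pairwise (fun k k' => Ξ.joinBottom P k' i ≤ Ξ.joinBottom P k i) :=
      List.pairwise_insertionSort _ _
    refine (hs.and hnd.2.1).imp_of_mem ?_
    rintro k k' hk hk' ⟨hle, hne⟩
    have h1 : Ξ.Joined P k i := by simpa [leftList] using hk
    have h2 : Ξ.Joined P k' i := by simpa [leftList] using hk'
    refine lt_of_le_of_ne (le_of_not_gt fun hlt => ?_) hne.symm
    rw [joinBottom_eq hP h1, joinBottom_eq hP h2] at hle
    rw [joined_iff_arc hP] at h1 h2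
    have h3 := h1.2 k' hlt h2.1.le
    have h4 := (le_max_left _ _).trans hle
    exact absurd (max_lt h3.1 h3.2) (not_lt.2 h4)
  · intro l hl k hk
    have h1 : Ξ.Joined P i l := by simpa [rightList] using hl
    have h2 : Ξ.Joined P k i := by simpa [leftList] using hk
    exact h2.lt.trans h1.lt

theorem rotDesc_combRibbon (hP : P ∈ Ξ.PositivePerm) : (Ξ.combRibbon P).RotDesc P.symm := by
  intro u r hr hmax
  obtain ⟨i, rfl⟩ := P.surjective u
  obtain ⟨j, rfl⟩ := P.surjective r
  set L := Ξ.rightList P i ++ Ξ.leftList P i with hL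
  have hmem : ∀ j, j ∈ L ↔ (Ξ.combRibbon P).graph.Adj (P i) (P j) := fun j =>
    (Ξ.mem_rotList P).trans (Ξ.combGraph_adj P).symm
  have hsort : L.Pairwise (· > ·) := pairwise_rotList hP i
  have hnd : L.Nodup := Ξ.nodup_rotList P i
  have hdeg : (Ξ.combRibbon P).deg (P i) = L.length := by
    classical
    have : (Ξ.combRibbon P).graph.neighborSet (P i) = ((L.toFinset.map P.toEmbedding :
        Finset S) : Set S) := by
      ext v
      obtain ⟨j, rfl⟩ := P.surjective v
      simp [hmem]
    rw [RibbonGraph.deg, this, Set.ncard_coe_finset, Finset.card_map,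
      List.toFinset_card_of_nodup hnd]
  have hpow : ∀ n, ((Ξ.combRibbon P).rot (P i) ^ n) (P j) = P ((L.formPerm ^ n) j) := by
    intro n
    have h1 : (Ξ.combRibbon P).rot (P i) = P.permCongrHom L.formPerm := by
      change Ξ.combRot P (P i) = _
      rw [combRot, Equiv.symm_apply_apply]
      rfl
    rw [h1, ← map_pow]
    simp [Equiv.permCongrHom, Equiv.permCongr_apply]
  have h0 : 0 < L.length := List.length_pos_of_mem ((hmem j).2 hr)
  -- The list is decreasing, so the largest neighbor is its head.
  have hj : j = L[0] := by
    obtain ⟨n, hn, rfl⟩ := List.getElem_of_mem ((hmem j).2 hr)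
    rcases Nat.eq_zero_or_pos n with rfl | hn0
    · rfl
    · have h2 := hmax _ ((hmem _).1 (List.getElem_mem h0))
      rw [Equiv.symm_apply_apply, Equiv.symm_apply_apply] at h2
      exact absurd (List.pairwise_iff_getElem.1 hsort 0 n h0 hn hn0) (not_lt.2 h2)
  intro n m hnm hm
  rw [hdeg] at hm
  rw [hpow, hpow, Equiv.symm_apply_apply, Equiv.symm_apply_apply, hj,
    List.formPerm_pow_apply_getElem _ hnd, List.formPerm_pow_apply_getElem _ hnd]
  simp only [Nat.zero_add, Nat.mod_eq_of_lt hm, Nat.mod_eq_of_lt (hnm.trans hm)]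
  exact List.pairwise_iff_getElem.1 hsort n m _ hm hnm

end FullPassport

/-! ### Combing recovers a tree from a noncrossing order -/

namespace RibbonGraph

/-- In the order given by `f`, black vertices precede all their neighbors, and no two edges
cross when they are drawn as arcs above a line. -/
structure IsNonCrossing {S α : Type*} [Preorder α] (T : RibbonGraph S) (f : S → α) : Prop where
  lt_of_black : ∀ u v, T.graph.Adj u v → u ∈ T.black → f u < f v
  not_crossing : ∀ u v x y, T.graph.Adj u v → T.graph.Adj x y →
    f u < f x → f x < f v → f v < f y → False

end RibbonGraph

namespace FullPassport

variable {S : Type*} [Fintype S] {Ξ : FullPassport S} {P : Permutation S} {T : RibbonGraph S}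

theorem IsPlaneTree.weight_nonneg (hT : Ξ.IsPlaneTree T) (e : Sym2 S) : 0 ≤ T.weight e := by
  by_cases he : e ∈ T.graph.edgeSet
  · exact (hT.weight_pos e he).le
  · exact (T.weight_eq_zero e he).ge

theorem IsPlaneTree.mem_black_iff (hT : Ξ.IsPlaneTree T) (v : S) :
    v ∈ T.black ↔ 0 < Ξ.wt v := by
  have h1 : 0 ≤ ∑ u, T.weight s(v, u) := Finset.sum_nonneg fun u _ => hT.weight_nonneg _
  have h2 := hT.vertexWeight_eq v
  have h3 := Ξ.wt_ne_zero v
  rw [RibbonGraph.vertexWeight] at h2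
  split_ifs at h2 with hb
  · exact iff_of_true hb (lt_of_le_of_ne (h2 ▸ h1) h3.symm)
  · exact iff_of_false hb (not_lt.2 (by linarith))

/-- The partial sums are the total weights of the edges that pass over the gaps. -/
theorem IsPlaneTree.cumSum_eq_sum (hT : Ξ.IsPlaneTree T) (hf : T.IsNonCrossing P.symm) (n : ℕ) :
    Ξ.cumSum P n = ∑ e : Fin (Fintype.card S) × Fin (Fintype.card S) with
      (e.1 : ℕ) < n ∧ n ≤ e.2, T.weight s(P e.1, P e.2) := by
  classical
  let W : Fin (Fintype.card S) → Fin (Fintype.card S) → ℝ := fun i j => T.weight s(P i, P j)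
  let σ : Fin (Fintype.card S) → ℝ := fun i => if P i ∈ T.black then 1 else -1
  have hwt : ∀ i, Ξ.wt (P i) = ∑ j, σ i * W i j := by
    intro i
    rw [← hT.vertexWeight_eq, RibbonGraph.vertexWeight, ← Finset.mul_sum,
      ← Equiv.sum_comp P (fun u => T.weight s(P i, u))]
    simp only [σ, W]
    split_ifs <;> simp
  have hW : ∀ i j, ¬ T.graph.Adj (P i) (P j) → W i j = 0 := fun i j h => T.weight_eq_zero _ h
  have hanti : ∀ i j, σ j * W j i = -(σ i * W i j) := by
    intro i j
    have hs : W j i = W i j := by simp only [W, Sym2.eq_swap]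
    rw [hs]
    by_cases h : T.graph.Adj (P i) (P j)
    · have := hT.bicolored _ _ h
      simp only [σ]
      by_cases h1 : P i ∈ T.black <;> simp_all
    · simp [hW i j h]
  -- An edge with both ends before the gap is counted at its black and at its white end, with
  -- opposite signs.
  have hzero : ∑ i : Fin (Fintype.card S), ∑ j : Fin (Fintype.card S),
      (if (i : ℕ) < n ∧ (j : ℕ) < n then σ i * W i j else 0) = 0 := by
    have h1 : ∑ i : Fin (Fintype.card S), ∑ j : Fin (Fintype.card S),
      (if (i : ℕ) < n ∧ (j : ℕ) < n then σ i * W i j else 0) =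
        -∑ i : Fin (Fintype.card S), ∑ j : Fin (Fintype.card S),
      (if (i : ℕ) < n ∧ (j : ℕ) < n then σ i * W i j else 0) := by
      conv_lhs => rw [Finset.sum_comm]
      simp only [← Finset.sum_neg_distrib]
      refine Finset.sum_congr rfl fun i _ => Finset.sum_congr rfl fun j _ => ?_
      rw [hanti]
      by_cases hi : (i : ℕ) < n <;> by_cases hj : (j : ℕ) < n <;> simp [hi, hj]
    linarith
  rw [cumSum, Finset.sum_filter, Finset.sum_filter, Fintype.sum_prod_type]
  refine Eq.trans (b := (∑ i : Fin (Fintype.card S), ∑ j : Fin (Fintype.card S),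
      (if (i : ℕ) < n ∧ (j : ℕ) < n then σ i * W i j else 0)) + _) ?_ (by rw [hzero, zero_add])
  rw [← Finset.sum_add_distrib]
  refine Finset.sum_congr rfl fun i _ => ?_
  rw [hwt, ← Finset.sum_add_distrib]
  by_cases hi : (i : ℕ) < n
  swap
  · simp [hi]
  rw [if_pos hi]
  refine Finset.sum_congr rfl fun j _ => ?_
  by_cases hj : (j : ℕ) < n
  · simp [hi, hj]
  · rw [if_neg (fun h => hj h.2), if_pos ⟨hi, not_lt.1 hj⟩, zero_add]
    by_cases h : T.graph.Adj (P i) (P j)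
    · have hb : P i ∈ T.black := by
        rw [hT.bicolored _ _ h]
        intro hb
        have := hf.lt_of_black _ _ h.symm hb
        rw [Equiv.symm_apply_apply, Equiv.symm_apply_apply] at this
        have : (j : ℕ) < i := this
        omega
      change σ i * W i j = W i j
      simp [σ, hb]
    · exact (congrArg _ (hW i j h)).trans ((mul_zero _).trans (hW i j h).symm)

/-- Let `E` consist of the pairs that reach from `k` or before to `l` or beyond. All of `E` passes
over each gap in `(k, l]`, and over one of them no other edge does, so the minimum there is the
weight of `E`. Since nothing crosses `k l`, the larger of `H k` and `H (l + 1)` is the weight of `E`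
without `(k, l)`. The difference is the weight of the edge. -/
theorem IsPlaneTree.arc_and_height (hT : Ξ.IsPlaneTree T) (hf : T.IsNonCrossing P.symm)
    {k l : Fin (Fintype.card S)} (hkl : k < l) (h : T.graph.Adj (P k) (P l)) :
    Arc (Ξ.cumSum P) k l ∧ height (Ξ.cumSum P) k l = T.weight s(P k, P l) := by
  classical
  let W : Fin (Fintype.card S) × Fin (Fintype.card S) → ℝ := fun e => T.weight s(P e.1, P e.2)
  have hW0 : ∀ e, 0 ≤ W e := fun e => hT.weight_nonneg _
  have hWa : ∀ e, ¬ T.graph.Adj (P e.1) (P e.2) → W e = 0 := fun e h => T.weight_eq_zero _ h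
  have hWpos : 0 < W (k, l) := hT.weight_pos _ h
  have hblack : ∀ i j, T.graph.Adj (P i) (P j) → i < j → P i ∈ T.black ∧ P j ∉ T.black := by
    intro i j ha hij
    have hj : P j ∉ T.black := fun hb => by
      have := hf.lt_of_black _ _ ha.symm hb
      rw [Equiv.symm_apply_apply, Equiv.symm_apply_apply] at this
      exact lt_asymm hij this
    exact ⟨(hT.bicolored _ _ ha).2 hj, hj⟩
  have hcross : ∀ i j i' j', T.graph.Adj (P i) (P j) → T.graph.Adj (P i') (P j') →
      i < i' → i' < j → j < j' → False := by
    intro i j i' j' h1 h2 h3 h4 h5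
    exact hf.not_crossing _ _ _ _ h1 h2 (by simpa) (by simpa) (by simpa)
  have hkb := (hblack k l h hkl).1
  have hlw := (hblack k l h hkl).2
  have hover : ∀ i j, T.graph.Adj (P i) (P j) → i < k → k ≤ j → l ≤ j := by
    intro i j ha hik hkj
    by_contra! hjl
    rcases hkj.eq_or_lt with rfl | hkj
    · exact (hblack i _ ha hik).2 hkb
    · exact hcross i j k l ha h hik hkj hjl
  have hover' : ∀ i j, T.graph.Adj (P i) (P j) → i ≤ l → l < j → i ≤ k := by
    intro i j ha hil hlj
    by_contra! hki
    rcases hil.eq_or_lt with rfl | hil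
    · exact hlw (hblack _ j ha hlj).1
    · exact hcross k l i j h ha hki hil hlj
  let E : Finset (Fin (Fintype.card S) × Fin (Fintype.card S)) :=
    Finset.univ.filter fun e => e.1 ≤ k ∧ l ≤ e.2
  have hkE : (k, l) ∈ E := Finset.mem_filter.2 ⟨Finset.mem_univ _, le_rfl, le_rfl⟩
  have hE : ∑ e ∈ E, W e = ∑ e ∈ E.erase (k, l), W e + W (k, l) :=
    (Finset.sum_erase_add _ _ hkE).symm
  have hH : ∀ n, Ξ.cumSum P n = ∑ e : Fin (Fintype.card S) × Fin (Fintype.card S) with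
      (e.1 : ℕ) < n ∧ n ≤ e.2, W e := hT.cumSum_eq_sum hf
  have hle : ∀ A B : Finset (Fin (Fintype.card S) × Fin (Fintype.card S)),
      (∀ e ∈ A, T.graph.Adj (P e.1) (P e.2) → e ∈ B) → ∑ e ∈ A, W e ≤ ∑ e ∈ B, W e := by
    intro A B hAB
    calc ∑ e ∈ A, W e = ∑ e ∈ A with T.graph.Adj (P e.1) (P e.2), W e := by
          refine (Finset.sum_filter_of_ne fun e _ hne => ?_).symm
          by_contra hna
          exact hne (hWa e hna)
      _ ≤ ∑ e ∈ B, W e := by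
          refine Finset.sum_le_sum_of_subset_of_nonneg (fun e he => ?_) fun e _ _ => hW0 e
          exact hAB e (Finset.mem_filter.1 he).1 (Finset.mem_filter.1 he).2
  have hfull : ∀ m, (k : ℕ) < m → m ≤ l → ∑ e ∈ E, W e ≤ Ξ.cumSum P m := by
    intro m h1 h2
    rw [hH]
    refine hle _ _ fun e he _ => ?_
    obtain ⟨h3, h4⟩ := (Finset.mem_filter.1 he).2
    have h3 : (e.1 : ℕ) ≤ k := h3
    have h4 : (l : ℕ) ≤ e.2 := h4
    exact Finset.mem_filter.2 ⟨Finset.mem_univ _, by omega, by omega⟩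
  have hk : Ξ.cumSum P k ≤ ∑ e ∈ E.erase (k, l), W e := by
    rw [hH]
    refine hle _ _ fun e he ha => ?_
    obtain ⟨h3, h4⟩ := (Finset.mem_filter.1 he).2
    refine Finset.mem_erase.2 ⟨?_, Finset.mem_filter.2 ⟨Finset.mem_univ _, h3.le, ?_⟩⟩
    · rintro rfl
      exact lt_irrefl _ h3
    · exact hover _ _ ha h3 h4
  have hl : Ξ.cumSum P (l + 1) ≤ ∑ e ∈ E.erase (k, l), W e := by
    rw [hH]
    refine hle _ _ fun e he ha => ?_
    obtain ⟨h3, h4⟩ := (Finset.mem_filter.1 he).2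
    refine Finset.mem_erase.2 ⟨?_, Finset.mem_filter.2 ⟨Finset.mem_univ _, ?_, ?_⟩⟩
    · rintro rfl
      exact absurd h4 (Nat.not_succ_le_self _)
    · exact hover' _ _ ha (Nat.lt_succ_iff.1 h3) h4
    · exact (Nat.lt_of_succ_le h4).le
  -- If `k` has a neighbor beyond `l`, no edge from before `k` ends at `l`, and all remaining edges
  -- of `E` pass over gap `l + 1`. Otherwise none of them starts at `k`, and all pass over gap `k`.
  have hmax : ∑ e ∈ E.erase (k, l), W e ≤ max (Ξ.cumSum P k) (Ξ.cumSum P (l + 1)) := by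
    by_cases hex : ∃ j, l < j ∧ T.graph.Adj (P k) (P j)
    · obtain ⟨j, hlj, hj⟩ := hex
      refine le_max_of_le_right ?_
      rw [hH]
      refine hle _ _ fun e he ha => ?_
      obtain ⟨hne, he⟩ := Finset.mem_erase.1 he
      obtain ⟨h3, h4⟩ := (Finset.mem_filter.1 he).2
      obtain ⟨e1, e2⟩ := e
      have h6 : l < e2 := by
        refine lt_of_le_of_ne h4 ?_
        rintro rfl
        rcases h3.eq_or_lt with h3 | h3
        · exact hne (Prod.ext h3 rfl)
        · exact hcross _ _ _ _ ha hj h3 hkl hlj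
      exact Finset.mem_filter.2 ⟨Finset.mem_univ _, Nat.lt_succ_of_le (h3.trans hkl.le), h6⟩
    · push Not at hex
      refine le_max_of_le_left ?_
      rw [hH]
      refine hle _ _ fun e he ha => ?_
      obtain ⟨hne, he⟩ := Finset.mem_erase.1 he
      obtain ⟨h3, h4⟩ := (Finset.mem_filter.1 he).2
      obtain ⟨e1, e2⟩ := e
      refine Finset.mem_filter.2 ⟨Finset.mem_univ _, lt_of_le_of_ne h3 ?_, hkl.le.trans h4⟩
      rintro h5
      have h5 : e1 = k := Fin.ext h5
      subst h5
      rcases h4.eq_or_lt with h4 | h4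
      · exact hne (Prod.ext rfl h4.symm)
      · exact hex _ h4 ha
  -- The gap is taken just after the last neighbor `q` of `k` before `l`, or just after `k` if there
  -- is none. An edge over it that starts after `k` would cross `k q` or make `q` black.
  have hlow : ∃ m, (k : ℕ) < m ∧ m ≤ l ∧ Ξ.cumSum P m ≤ ∑ e ∈ E, W e := by
    let A : Finset (Fin (Fintype.card S)) :=
      insert k (Finset.univ.filter fun j => j < l ∧ T.graph.Adj (P k) (P j))
    obtain ⟨q, hq, hqmax⟩ := A.exists_max_image id ⟨k, Finset.mem_insert_self _ _⟩
    have hkq : k ≤ q := hqmax k (Finset.mem_insert_self _ _)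
    have hqA : q = k ∨ q < l ∧ T.graph.Adj (P k) (P q) := by
      simpa [A] using hq
    have hql : q < l := by
      rcases hqA with rfl | hqA
      exacts [hkl, hqA.1]
    refine ⟨q + 1, Nat.lt_succ_of_le hkq, hql, ?_⟩
    rw [hH]
    refine hle _ _ fun e he ha => ?_
    obtain ⟨e1, e2⟩ := e
    obtain ⟨h3, h4⟩ := (Finset.mem_filter.1 he).2
    have h3 : e1 ≤ q := Nat.lt_succ_iff.1 h3
    have h4 : q < e2 := h4
    have h5 : e1 ≤ k := by
      by_contra! h5
      rcases hqA with rfl | hqA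
      · exact absurd h3 (not_le.2 h5)
      · rcases h3.eq_or_lt with rfl | h3
        · exact (hblack _ _ hqA.2 h5).2 (hblack _ _ ha h4).1
        · exact hcross _ _ _ _ hqA.2 ha h5 h3 h4
    refine Finset.mem_filter.2 ⟨Finset.mem_univ _, h5, ?_⟩
    rcases h5.eq_or_lt with rfl | h5
    · by_contra! h6
      have h7 : e2 ∈ A := by simp [A, h6, show T.graph.Adj (P e1) (P e2) from ha]
      exact absurd (hqmax e2 h7) (not_le.2 h4)
    · exact hover _ _ ha h5 (hkq.trans h4.le)
  have harc : Arc (Ξ.cumSum P) k l := by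
    refine ⟨hkl, fun m h1 h2 => ?_⟩
    have := hfull m h1 h2
    exact ⟨by linarith, by linarith⟩
  refine ⟨harc, ?_⟩
  obtain ⟨m, h1, h2, h3⟩ := hlow
  obtain ⟨m', h1', h2', h3'⟩ := exists_eq_low (Ξ.cumSum P) harc.1
  have h4 := low_le (Ξ.cumSum P) h1 h2
  have h5 := hfull m' h1' h2'
  have h6 := max_le hk hl
  rw [height_of_arc harc]
  change _ = W (k, l)
  linarith

theorem IsPlaneTree.ncard_edgeSet (hT : Ξ.IsPlaneTree T) :
    T.graph.edgeSet.ncard + 1 = Fintype.card S := by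
  have := (SimpleGraph.isTree_iff_connected_and_card.1 hT.isTree).2
  rwa [Nat.card_coe_set_eq, Nat.card_eq_fintype_card] at this

theorem IsPlaneTree.comb_eq [Nonempty S] (hT : Ξ.IsPlaneTree T) (hf : T.IsNonCrossing P.symm)
    (hrot : T.RotDesc P.symm) {a b : S} (hab : T.graph.Adj a b)
    (ha : P ⟨0, Fintype.card_pos⟩ = a)
    (hb : P ⟨Fintype.card S - 1, Nat.sub_lt Fintype.card_pos Nat.one_pos⟩ = b) :
    P ∈ Ξ.PositiveTreePerm ∧ Ξ.comb P = (T, a, b) := by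
  have hN := Ξ.two_le_card
  have hpos : P ∈ Ξ.PositivePerm := by
    intro m h1 h2
    rw [← ha, ← hb] at hab
    have h3 := (hT.arc_and_height hf
      (show (⟨0, _⟩ : Fin (Fintype.card S)) < ⟨Fintype.card S - 1, _⟩ from
        show 0 < Fintype.card S - 1 by omega) hab).1.2 m h1
        (show m ≤ Fintype.card S - 1 by omega)
    rw [cumSum_zero] at h3
    exact h3.1
  have hle : T.graph.edgeSet ⊆ (Ξ.combGraph P).edgeSet := by
    intro e he
    induction e with | _ u v
    obtain ⟨i, rfl⟩ := P.surjective u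
    obtain ⟨j, rfl⟩ := P.surjective v
    have he : T.graph.Adj (P i) (P j) := he
    change (Ξ.combGraph P).Adj (P i) (P j)
    rw [combGraph_adj_iff_arc hpos]
    rcases lt_trichotomy i j with h | rfl | h
    · exact Or.inl (hT.arc_and_height hf h he).1
    · exact absurd he (SimpleGraph.irrefl _)
    · exact Or.inr (hT.arc_and_height hf h he.symm).1
  obtain ⟨E, hE, hcard⟩ := card_edgeSet_le hpos
  have hcT := hT.ncard_edgeSet
  have hgraph : T.graph = Ξ.combGraph P := by
    rw [← SimpleGraph.edgeSet_inj]
    refine Set.eq_of_subset_of_ncard_le hle ?_ (Set.toFinite _)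
    have := card_arcs_lt E hE Fintype.card_pos
    omega
  have hle' := Set.ncard_le_ncard hle (Set.toFinite _)
  refine ⟨⟨hpos, fun i h1 h2 => (hpos i h1 h2).ne', ?_, ?_⟩, ?_⟩
  · intro a l hal hl he h0
    have hlN : l < Fintype.card S := by
      refine lt_of_le_of_ne hl ?_
      rintro rfl
      rw [cumSum_card] at h0
      exact lt_irrefl _ h0
    -- A violation leaves at most N - 2 arcs, fewer than the edges of the tree.
    by_contra! hno
    have := card_arcs_add_one_lt E hE (by omega) hlN he hno
    omega
  · intro a l hal hl he h0
    exact absurd (cumSum_nonneg hpos hl) (not_le.2 h0)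
  · refine Prod.ext ?_ (Prod.ext ha hb)
    refine RibbonGraph.ext hgraph.symm ?_ ?_ ?_
    · ext v
      exact (hT.mem_black_iff v).symm
    · funext e
      by_cases he : e ∈ T.graph.edgeSet
      · induction e with | _ u v
        obtain ⟨i, rfl⟩ := P.surjective u
        obtain ⟨j, rfl⟩ := P.surjective v
        have he : T.graph.Adj (P i) (P j) := he
        change Ξ.combWeight P s(P i, P j) = _
        rcases lt_trichotomy i j with h | rfl | h
        · rw [combWeight_of_lt hpos h, (hT.arc_and_height hf h he).2]
        · exact absurd he (SimpleGraph.irrefl _)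
        · rw [Sym2.eq_swap, combWeight_of_lt hpos h, (hT.arc_and_height hf h he.symm).2]
      · rw [T.weight_eq_zero e he]
        exact (Ξ.combRibbon P).weight_eq_zero e (show e ∉ (Ξ.combGraph P).edgeSet from hgraph ▸ he)
    · exact (rotDesc_combRibbon hpos).rot_eq P.symm.injective hrot hgraph.symm

end FullPassport

/-! ### Rooted trees and uniqueness of the contour order -/

/-- The graph `G` is a tree with root `a`, in which `p v` is the parent of the vertex `v ≠ a` and
`d v` is the distance from `v` to the root. -/
structure SimpleGraph.IsRootedAt {S : Type*} (G : SimpleGraph S) (a : S) (p : S → S)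
    (d : S → ℕ) : Prop where
  depth_root : d a = 0
  adj_parent : ∀ v, v ≠ a → G.Adj v (p v)
  depth_eq : ∀ v, v ≠ a → d v = d (p v) + 1
  eq_parent : ∀ u v, G.Adj u v → u ≠ a ∧ p u = v ∨ v ≠ a ∧ p v = u

/-- A parent is a neighbor that is closer to the root. The edges `s(v, p v)` with `v ≠ a` are
distinct and as numerous as all edges, so every edge joins a vertex to its parent. -/
theorem SimpleGraph.IsTree.exists_isRootedAt {S : Type*} [Finite S] {G : SimpleGraph S}
    (hG : G.IsTree) (a : S) : ∃ p d, G.IsRootedAt a p d := by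
  classical
  have hex : ∀ v, ∃ w, v ≠ a → G.Adj v w ∧ G.dist a v = G.dist a w + 1 := by
    intro v
    by_cases hv : v = a
    · exact ⟨v, fun h => absurd hv h⟩
    obtain ⟨q, hq⟩ := (hG.connected v a).exists_walk_length_eq_dist
    cases q with
    | nil => exact absurd rfl hv
    | @cons _ w _ h q =>
      refine ⟨w, fun _ => ⟨h, ?_⟩⟩
      have h1 := SimpleGraph.dist_le q
      rw [SimpleGraph.Walk.length_cons] at hq
      rw [SimpleGraph.dist_comm] at hq h1
      rcases hG.dist_eq_dist_add_one_of_adj a h with h2 | h2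
      · exact h2
      · omega
  choose p hp using hex
  refine ⟨p, G.dist a, SimpleGraph.dist_self, fun v hv => (hp v hv).1, fun v hv => (hp v hv).2, ?_⟩
  have hcard := (SimpleGraph.isTree_iff_connected_and_card.1 hG).2
  rw [Nat.card_coe_set_eq] at hcard
  have hinj : Set.InjOn (fun v => s(v, p v)) {a}ᶜ := by
    intro v hv w hw h
    rcases Sym2.eq_iff.1 h with h | ⟨h1, h2⟩
    · exact h.1
    · have h3 := (hp v hv).2
      have h4 := (hp w hw).2
      rw [h2] at h3
      rw [← h1] at h4
      omega
  have himg : (fun v => s(v, p v)) '' {a}ᶜ = G.edgeSet := by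
    refine Set.eq_of_subset_of_ncard_le ?_ ?_ (Set.toFinite _)
    · rintro _ ⟨v, hv, rfl⟩
      exact (hp v hv).1
    · rw [hinj.ncard_image, Set.ncard_compl, Set.ncard_singleton]
      omega
  intro u v huv
  have hmem : s(u, v) ∈ G.edgeSet := huv
  rw [← himg] at hmem
  obtain ⟨w, hw, h⟩ := hmem
  rcases Sym2.eq_iff.1 h with ⟨rfl, h2⟩ | ⟨rfl, h2⟩
  · exact Or.inl ⟨hw, h2⟩
  · exact Or.inr ⟨hw, h2⟩

namespace RibbonGraph

variable {S α β : Type*} [LinearOrder α] [LinearOrder β] {T : RibbonGraph S} {f : S → α}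
  {f' : S → β} {a b : S} {p : S → S} {d : S → ℕ}

theorem IsNonCrossing.parent_between (hf : T.IsNonCrossing f) (hinj : f.Injective)
    (ha : ∀ v, f a ≤ f v) (hr : T.graph.IsRootedAt a p d) {x y z : S} (h : T.graph.Adj y z)
    (hy : f y < f x) (hz : f x < f z) :
    x ≠ a ∧ (p x = y ∨ p x = z ∨ f y < f (p x) ∧ f (p x) < f z) := by
  have hx : x ≠ a := by
    rintro rfl
    exact (ha y).not_gt hy
  have hadj := hr.adj_parent x hx
  refine ⟨hx, ?_⟩
  rcases lt_trichotomy (f (p x)) (f y) with h1 | h1 | h1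
  · exact (hf.not_crossing _ _ _ _ hadj.symm h h1 hy hz).elim
  · exact Or.inl (hinj h1)
  rcases lt_trichotomy (f (p x)) (f z) with h2 | h2 | h2
  · exact Or.inr (Or.inr ⟨h1, h2⟩)
  · exact Or.inr (Or.inl (hinj h2))
  · exact (hf.not_crossing _ _ _ _ h hadj hy hz h2).elim

/-- The ancestors of a vertex strictly under the edge `y z` can leave the interval only through `y`
or `z`. They have to leave it, because the root is the leftmost vertex. -/
theorem IsNonCrossing.min_depth_lt (hf : T.IsNonCrossing f) (hinj : f.Injective)
    (ha : ∀ v, f a ≤ f v) (hr : T.graph.IsRootedAt a p d) {x y z : S} (h : T.graph.Adj y z)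
    (hy : f y < f x) (hz : f x < f z) : min (d y) (d z) < d x := by
  induction hn : d x generalizing x with
  | zero =>
    have := hr.depth_eq x (hf.parent_between hinj ha hr h hy hz).1
    omega
  | succ n ih =>
    obtain ⟨hx, h1⟩ := hf.parent_between hinj ha hr h hy hz
    have h2 := hr.depth_eq x hx
    rcases h1 with h1 | h1 | ⟨h1, h3⟩
    · rw [h1] at h2
      omega
    · rw [h1] at h2
      omega
    · have := ih h1 h3 (by omega)
      omega

/-- If a child `z` stood beyond `p u`, the parent would lie strictly under the edge `u z`, both of
whose ends are deeper. So the parent is the last neighbor of a black vertex; dually, it is the first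
neighbor of a white one. -/
theorem IsNonCrossing.le_parent (hf : T.IsNonCrossing f) (hinj : f.Injective)
    (ha : ∀ v, f a ≤ f v) (hr : T.graph.IsRootedAt a p d) {u z : S} (hu : u ≠ a)
    (hb : u ∈ T.black) (hz : T.graph.Adj u z) : f z ≤ f (p u) := by
  by_contra! h
  have h1 := hf.min_depth_lt hinj ha hr hz (hf.lt_of_black _ _ (hr.adj_parent u hu) hb) h
  have h2 := hr.depth_eq u hu
  rcases hr.eq_parent u z hz with ⟨-, h3⟩ | ⟨h3, h4⟩
  · rw [h3] at h
    exact lt_irrefl _ h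
  · have := hr.depth_eq z h3
    rw [h4] at this
    omega

theorem IsNonCrossing.parent_le (hf : T.IsNonCrossing f) (hinj : f.Injective)
    (ha : ∀ v, f a ≤ f v) (hr : T.graph.IsRootedAt a p d) {u z : S} (hu : u ≠ a)
    (hb : p u ∈ T.black) (hz : T.graph.Adj u z) : f (p u) ≤ f z := by
  by_contra! h
  have h1 := hf.min_depth_lt hinj ha hr hz.symm h
    (hf.lt_of_black _ _ (hr.adj_parent u hu).symm hb)
  have h2 := hr.depth_eq u hu
  rcases hr.eq_parent u z hz with ⟨-, h3⟩ | ⟨h3, h4⟩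
  · rw [h3] at h
    exact lt_irrefl _ h
  · have := hr.depth_eq z h3
    rw [h4] at this
    omega

theorem RotDesc.lt_iff_of_max (hT : T.RotDesc f) {u r : S} (hr : T.graph.Adj u r)
    (hmax : ∀ z, T.graph.Adj u z → f z ≤ f r) {n m : ℕ} (hn : n < T.deg u) (hm : m < T.deg u) :
    f ((T.rot u ^ n) r) < f ((T.rot u ^ m) r) ↔ m < n := by
  constructor
  · intro h
    by_contra! h'
    rcases h'.eq_or_lt with rfl | h'
    · exact lt_irrefl _ h
    · exact lt_asymm h (hT u r hr hmax n m h' hm)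
  · exact fun h => hT u r hr hmax m n h hn

/-- The conditions that single out one ordering of the vertices of a rooted tree. -/
structure IsContourOrder (T : RibbonGraph S) (a b : S) (f : S → α) : Prop where
  injective : f.Injective
  root_le : ∀ v, f a ≤ f v
  le_last : ∀ v, f v ≤ f b
  isNonCrossing : T.IsNonCrossing f
  rotDesc : T.RotDesc f

/-- The claim is that `y` is not under the edge between `x` and `p x`. Otherwise `p y`, being
neither end, would be strictly under it too and hence deeper than `p x`, against `d y ≤ d x`. -/
theorem IsContourOrder.lt_iff_parent_lt (hf : T.IsContourOrder a b f)
    (hr : T.graph.IsRootedAt a p d) {x y : S} (hx : x ≠ a) (hd : d y ≤ d x) (hxy : x ≠ y)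
    (hy : ¬ T.graph.Adj (p x) y) (hy' : y ≠ p x) : f x < f y ↔ f (p x) < f y := by
  have key : ∀ s t, T.graph.Adj s t → (s = x ∧ t = p x ∨ s = p x ∧ t = x) → f s < f y →
      f y < f t → False := by
    intro s t hst hcase h1 h2
    obtain ⟨h3, h4⟩ := hf.isNonCrossing.parent_between hf.injective hf.root_le hr hst h1 h2
    have h5 := hr.depth_eq y h3
    have h6 := hr.depth_eq x hx
    have hpx : p y ≠ p x := fun h => hy (h ▸ (hr.adj_parent y h3).symm)
    have hpy : p y ≠ x := by
      intro h
      rw [h] at h5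
      omega
    have h7 : f s < f (p y) ∧ f (p y) < f t := by
      rcases hcase with ⟨rfl, rfl⟩ | ⟨rfl, rfl⟩ <;> tauto
    have h8 := hf.isNonCrossing.min_depth_lt hf.injective hf.root_le hr hst h7.1 h7.2
    rcases hcase with ⟨rfl, rfl⟩ | ⟨rfl, rfl⟩ <;> omega
  have hadj := hr.adj_parent x hx
  constructor
  · intro h
    by_contra! h'
    exact key _ _ hadj (Or.inl ⟨rfl, rfl⟩) h
      (lt_of_le_of_ne h' fun he => hy' (hf.injective he))
  · intro h
    by_contra! h'
    exact key _ _ hadj.symm (Or.inr ⟨rfl, rfl⟩) h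
      (lt_of_le_of_ne h' fun he => hxy (hf.injective he.symm))

variable [Fintype S]

/-- The smallest neighbor comes last in the decreasing list, and the rotation wraps around to the
first. -/
theorem RotDesc.le_rot_of_min (hT : T.RotDesc f) {u m : S} (hm : T.graph.Adj u m)
    (hmin : ∀ z, T.graph.Adj u z → f m ≤ f z) {z : S} (hz : T.graph.Adj u z) :
    f z ≤ f (T.rot u m) := by
  obtain ⟨r, hr, hmax⟩ := T.exists_max_adj f hm
  obtain ⟨n, hn, rfl⟩ := T.exists_rot_pow_eq hr hm
  rcases (Nat.succ_le_of_lt hn).eq_or_lt with h | h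
  · rw [← Equiv.Perm.mul_apply, ← pow_succ', ← Nat.succ_eq_add_one, h, T.rot_pow_deg hr]
    exact hmax z hz
  · exact absurd (hmin _ (T.adj_rot_pow hr (n + 1)))
      (not_le.2 (hT u r hr hmax n (n + 1) (Nat.lt_succ_self n) h))

/-- The largest neighbor can be named without the order: `b` at the root, the parent at another
black vertex, and the successor of the parent at a white vertex. -/
theorem IsContourOrder.exists_common_max (hf : T.IsContourOrder a b f)
    (hf' : T.IsContourOrder a b f') (hr : T.graph.IsRootedAt a p d) (hab : T.graph.Adj a b)
    (hbic : ∀ u v, T.graph.Adj u v → (u ∈ T.black ↔ v ∉ T.black)) (u : S) :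
    ∃ r, T.graph.Adj u r ∧ (∀ z, T.graph.Adj u z → f z ≤ f r) ∧
      ∀ z, T.graph.Adj u z → f' z ≤ f' r := by
  by_cases hu : u = a
  · subst hu
    exact ⟨b, hab, fun z _ => hf.le_last z, fun z _ => hf'.le_last z⟩
  have hadj := hr.adj_parent u hu
  by_cases hb : u ∈ T.black
  · exact ⟨p u, hadj,
      fun z => hf.isNonCrossing.le_parent hf.injective hf.root_le hr hu hb,
      fun z => hf'.isNonCrossing.le_parent hf'.injective hf'.root_le hr hu hb⟩
  · have hpb : p u ∈ T.black := by
      by_contra h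
      exact hb ((hbic _ _ hadj).2 h)
    exact ⟨T.rot u (p u), T.adj_rot_pow hadj 1,
      fun z => hf.rotDesc.le_rot_of_min hadj
        fun z => hf.isNonCrossing.parent_le hf.injective hf.root_le hr hu hpb,
      fun z => hf'.rotDesc.le_rot_of_min hadj
        fun z => hf'.isNonCrossing.parent_le hf'.injective hf'.root_le hr hu hpb⟩

/-- A rooted tree has at most one contour order. -/
theorem IsContourOrder.lt_iff_lt (hf : T.IsContourOrder a b f)
    (hf' : T.IsContourOrder a b f') (hG : T.graph.IsTree) (hab : T.graph.Adj a b)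
    (hbic : ∀ u v, T.graph.Adj u v → (u ∈ T.black ↔ v ∉ T.black)) (x y : S) :
    f x < f y ↔ f' x < f' y := by
  obtain ⟨p, d, hr⟩ := hG.exists_isRootedAt a
  have hswap : ∀ x y, (f x < f y ↔ f' x < f' y) → (f y < f x ↔ f' y < f' x) := by
    intro x y h
    by_cases hxy : x = y
    · subst hxy
      exact h
    have h1 : f x ≠ f y := fun h => hxy (hf.injective h)
    have h2 : f' x ≠ f' y := fun h => hxy (hf'.injective h)
    have h3 := not_congr h
    rw [not_lt, not_lt] at h3
    constructor
    · exact fun h => lt_of_le_of_ne (h3.1 h.le) h2.symm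
    · exact fun h => lt_of_le_of_ne (h3.2 h.le) h1.symm
  induction hn : d x + d y using Nat.strong_induction_on generalizing x y with
  | _ n ih =>
  subst hn
  wlog hd : d y ≤ d x generalizing x y
  · exact hswap _ _ (this y x (fun m hm x y h => ih m (by omega) x y h) (by omega))
  by_cases hxy : x = y
  · subst hxy
    exact iff_of_false (lt_irrefl _) (lt_irrefl _)
  have hx : x ≠ a := by
    rintro rfl
    rw [hr.depth_root, Nat.le_zero] at hd
    have := hr.depth_eq y (Ne.symm hxy)
    omega
  have hadj := hr.adj_parent x hx
  by_cases hy' : y = p x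
  · subst hy'
    by_cases hb : x ∈ T.black
    · exact iff_of_true (hf.isNonCrossing.lt_of_black _ _ hadj hb)
        (hf'.isNonCrossing.lt_of_black _ _ hadj hb)
    · have hpb : p x ∈ T.black := by
        by_contra h
        exact hb ((hbic _ _ hadj).2 h)
      exact iff_of_false (hf.isNonCrossing.lt_of_black _ _ hadj.symm hpb).not_gt
        (hf'.isNonCrossing.lt_of_black _ _ hadj.symm hpb).not_gt
  -- Siblings, or vertex and grandparent: the rotation at `p x`, read from the common largest
  -- neighbor, decides. In the remaining case `x` is replaced by its parent.
  by_cases hy : T.graph.Adj (p x) y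
  · obtain ⟨r, h1, h2, h3⟩ := hf.exists_common_max hf' hr hab hbic (p x)
    obtain ⟨n, hn, hx'⟩ := T.exists_rot_pow_eq h1 hadj.symm
    obtain ⟨m, hm, rfl⟩ := T.exists_rot_pow_eq h1 hy
    have h4 := hf.rotDesc.lt_iff_of_max h1 h2 hn hm
    have h5 := hf'.rotDesc.lt_iff_of_max h1 h3 hn hm
    rw [hx'] at h4 h5
    rw [h4, h5]
  · rw [hf.lt_iff_parent_lt hr hx hd hxy hy hy', hf'.lt_iff_parent_lt hr hx hd hxy hy hy']
    have := hr.depth_eq x hx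
    exact ih _ (by omega) _ _ rfl

end RibbonGraph

/-! ### Injectivity of the combing map -/

namespace FullPassport

variable {S : Type*} [Fintype S] {Ξ : FullPassport S} {P : Permutation S}

theorem isContourOrder_comb [Nonempty S] (hP : P ∈ Ξ.PositivePerm) :
    (Ξ.comb P).1.IsContourOrder (Ξ.comb P).2.1 (Ξ.comb P).2.2 P.symm := by
  refine ⟨P.symm.injective, ?_, ?_, ⟨?_, ?_⟩, rotDesc_combRibbon hP⟩
  · intro v
    rw [comb, Equiv.symm_apply_apply]
    exact Nat.zero_le _
  · intro v
    rw [comb, Equiv.symm_apply_apply]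
    exact Nat.le_sub_one_of_lt (P.symm v).isLt
  · intro u v huv hu
    obtain ⟨i, rfl⟩ := P.surjective u
    obtain ⟨j, rfl⟩ := P.surjective v
    rw [Equiv.symm_apply_apply, Equiv.symm_apply_apply]
    rcases (combGraph_adj_iff_arc hP).1 huv with h | h
    · exact h.1
    · exact absurd (wt_neg_of_arc h) (not_lt.2 (le_of_lt hu))
  · intro u v x y huv hxy h1 h2 h3
    obtain ⟨i, rfl⟩ := P.surjective u
    obtain ⟨j, rfl⟩ := P.surjective v
    obtain ⟨k, rfl⟩ := P.surjective x
    obtain ⟨l, rfl⟩ := P.surjective y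
    simp only [Equiv.symm_apply_apply] at h1 h2 h3
    rcases (combGraph_adj_iff_arc hP).1 huv with h | h
    · rcases (combGraph_adj_iff_arc hP).1 hxy with h' | h'
      · exact h.not_crossing h' h1 h2 h3
      · exact lt_asymm h'.1 (h2.trans h3)
    · exact lt_asymm h.1 (h1.trans h2)

theorem injOn_comb [Nonempty S] (Ξ : FullPassport S) : Set.InjOn Ξ.comb Ξ.PositiveTreePerm := by
  intro P hP P' hP' h
  have hT := comb_mem_rootedTree hP
  have h1 := isContourOrder_comb hP.1
  have h2 := isContourOrder_comb hP'.1
  rw [← h] at h2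
  have h3 := h1.lt_iff_lt h2 hT.1.isTree hT.2.1 hT.1.bicolored
  -- An increasing permutation of the positions is the identity.
  have h4 : StrictMono fun i => P'.symm (P i) := by
    intro i j hij
    exact (h3 _ _).1 (by simpa using hij)
  have h5 : (fun i => P'.symm (P i)) = id := by
    refine (StrictMono.range_inj h4 strictMono_id).1 ?_
    rw [Set.range_id]
    exact (P.trans P'.symm).surjective.range_eq
  ext i
  exact P'.symm_apply_eq.1 (congrFun h5 i)

end FullPassport

/-! ### Existence of the contour order: rational addresses -/

/-- The vertex `v ≠ a` of a rooted tree stands at distance `g v / (2 * N + 1) ^ d v` from its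
parent, where `g v` is a nonzero integer of absolute value at most `N`. -/
structure IsAddress {S : Type*} (a : S) (p : S → S) (d : S → ℕ) (g : S → ℤ) (N : ℕ)
    (f : S → ℚ) : Prop where
  root : f a = 0
  step : ∀ v, v ≠ a → f v = f (p v) + g v / (2 * N + 1) ^ d v
  ne_zero : ∀ v, v ≠ a → g v ≠ 0
  abs_g_le : ∀ v, v ≠ a → |g v| ≤ N

namespace IsAddress

variable {S : Type*} {G : SimpleGraph S} {a : S} {p : S → S} {d : S → ℕ} {g : S → ℤ} {N : ℕ}
  {f : S → ℚ}

theorem exists_of_isRootedAt (hr : G.IsRootedAt a p d) (hg0 : ∀ v, v ≠ a → g v ≠ 0)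
    (hg : ∀ v, v ≠ a → |g v| ≤ N) : ∃ f, IsAddress a p d g N f := by
  -- Recursion on the depth, carried out for all vertices at once; only the value of `F (d v)` at
  -- `v` is meaningful.
  let F : ℕ → S → ℚ := fun n => Nat.rec (fun _ => 0)
    (fun n F v => F (p v) + g v / (2 * N + 1) ^ (n + 1)) n
  refine ⟨fun v => F (d v) v, ?_, ?_, hg0, hg⟩
  · exact congrFun (congrArg F hr.depth_root) a
  · intro v hv
    simp only [hr.depth_eq v hv, F]

theorem exists_int (hf : IsAddress a p d g N f) (hr : G.IsRootedAt a p d) {n : ℕ} {v : S}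
    (hv : d v ≤ n) : ∃ c : ℤ, f v * (2 * N + 1) ^ n = c := by
  induction hm : d v generalizing v with
  | zero =>
    have hva : v = a := by
      by_contra h
      have := hr.depth_eq v h
      omega
    exact ⟨0, by rw [hva, hf.root]; simp⟩
  | succ m ih =>
    have hva : v ≠ a := by
      rintro rfl
      rw [hr.depth_root] at hm
      omega
    have hd := hr.depth_eq v hva
    obtain ⟨c, hc⟩ := ih (v := p v) (by omega) (by omega)
    refine ⟨c + g v * (2 * N + 1) ^ (n - d v), ?_⟩
    have h0 : (2 * (N : ℚ) + 1) ^ d v ≠ 0 := by positivity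
    have h1 : (2 * (N : ℚ) + 1) ^ n = (2 * N + 1) ^ (n - d v) * (2 * N + 1) ^ d v := by
      rw [← pow_add, Nat.sub_add_cancel hv]
    rw [hf.step v hva, add_mul, hc]
    push_cast
    rw [h1]
    field_simp

/-- The positions of a vertex `x`, of its parent and of all vertices that are closer to the root,
in multiples of the unit at the depth of `x`. -/
theorem exists_scale (hf : IsAddress a p d g N f) (hr : G.IsRootedAt a p d) {x : S}
    (hx : x ≠ a) : ∃ K : ℚ, 0 < K ∧
      (∀ z, d z < d x → ∃ c : ℤ, f z * K = ((c * (2 * N + 1) : ℤ) : ℚ)) ∧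
      ∀ y, y ≠ a → d y = d x → f y * K = f (p y) * K + (g y : ℚ) := by
  have hd := hr.depth_eq x hx
  refine ⟨(2 * N + 1) ^ d x, by positivity, fun z hz => ?_, fun y hy hyx => ?_⟩
  · obtain ⟨c, hc⟩ := hf.exists_int hr (n := d (p x)) (v := z) (by omega)
    refine ⟨c, ?_⟩
    rw [hd, pow_succ, ← mul_assoc, hc]
    push_cast
    rfl
  · rw [hf.step y hy, hyx, add_mul, div_mul_cancel₀]
    positivity

/-- In units of the depth of `x`, shallower vertices stand at multiples of `2 * N + 1`, while `x` is
at a nonzero distance of at most `N` from its parent. -/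
theorem not_between (hf : IsAddress a p d g N f) (hr : G.IsRootedAt a p d) {x z : S}
    (hx : x ≠ a) (hz : d z < d x) :
    f z ≠ f x ∧ (f (p x) < f z → f x < f z) ∧ (f z < f (p x) → f z < f x) := by
  obtain ⟨K, hK, h1, h2⟩ := hf.exists_scale hr hx
  obtain ⟨c, hc⟩ := h1 z hz
  obtain ⟨c', hc'⟩ := h1 (p x) (by have := hr.depth_eq x hx; omega)
  have hx' := h2 x hx rfl
  rw [hc'] at hx'
  have hne := hf.ne_zero x hx
  obtain ⟨hg1, hg2⟩ := abs_le.1 (hf.abs_g_le x hx)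
  have hN : (0 : ℤ) ≤ N := Nat.cast_nonneg N
  rw [← mul_lt_mul_iff_left₀ hK (b := f (p x)), ← mul_lt_mul_iff_left₀ hK (b := f x),
    ← mul_lt_mul_iff_left₀ hK (b := f z), ← mul_lt_mul_iff_left₀ hK (b := f z) (c := f x),
    ← (mul_left_injective₀ hK.ne').ne_iff, hx', hc, hc']
  norm_cast
  push_cast
  have hc1 : c < c' → c * (2 * N + 1) + (2 * N + 1) ≤ c' * (2 * N + 1) := by
    intro h
    nlinarith
  have hc2 : c' < c → c' * (2 * N + 1) + (2 * N + 1) ≤ c * (2 * N + 1) := by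
    intro h
    nlinarith
  rcases lt_trichotomy c c' with h | h | h
  · have := hc1 h
    refine ⟨by omega, fun h' => by omega, fun _ => by omega⟩
  · subst h
    refine ⟨by omega, fun h' => absurd h' (lt_irrefl _), fun h' => absurd h' (lt_irrefl _)⟩
  · have := hc2 h
    refine ⟨by omega, fun _ => by omega, fun h' => by omega⟩

/-- At equal depth, equal positions force equal parents' positions, because two offsets differ by at
most `2 * N`. Induction then identifies the parents, and `hg` the vertices. -/
theorem injective (hf : IsAddress a p d g N f) (hr : G.IsRootedAt a p d)
    (hg : ∀ x y, x ≠ a → y ≠ a → p x = p y → g x = g y → x = y) : f.Injective := by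
  have key : ∀ n x y, d x = n → d y ≤ n → f x = f y → x = y := by
    intro n
    induction n using Nat.strong_induction_on with
    | _ n ih =>
    intro x y hxn hyn hxy
    by_cases hx : x = a
    · by_contra h
      have := hr.depth_eq y (fun h' => h (hx.trans h'.symm))
      rw [hx, hr.depth_root] at hxn
      omega
    rcases hyn.lt_or_eq with hyn | hyn
    · exact absurd hxy.symm (hf.not_between hr hx (hxn ▸ hyn)).1
    have hy : y ≠ a := by
      rintro rfl
      rw [hr.depth_root] at hyn
      have := hr.depth_eq x hx
      omega
    have hdx := hr.depth_eq x hx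
    have hdy := hr.depth_eq y hy
    obtain ⟨K, hK, h1, h2⟩ := hf.exists_scale hr hx
    obtain ⟨c, hc⟩ := h1 (p x) (by omega)
    obtain ⟨c', hc'⟩ := h1 (p y) (by omega)
    have h3 := h2 x hx rfl
    have h4 := h2 y hy (by omega)
    rw [hxy, h4, hc, hc'] at h3
    obtain ⟨hg1, hg2⟩ := abs_le.1 (hf.abs_g_le x hx)
    obtain ⟨hg3, hg4⟩ := abs_le.1 (hf.abs_g_le y hy)
    have hN : (0 : ℤ) ≤ N := Nat.cast_nonneg N
    have h5 : c' * (2 * N + 1) + g y = c * (2 * N + 1) + g x := by exact_mod_cast h3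
    have h6 : c = c' := by
      rcases lt_trichotomy c c' with h | h | h
      · nlinarith
      · exact h
      · nlinarith
    subst h6
    refine hg x y hx hy ?_ (by omega)
    refine ih (d (p x)) (by omega) _ _ rfl (by omega) ?_
    exact mul_left_injective₀ hK.ne' (hc.trans hc'.symm)
  intro x y hxy
  rcases le_total (d x) (d y) with h | h
  · exact (key (d y) y x rfl h hxy.symm).symm
  · exact key (d x) x y rfl h hxy

/-- Two edges at the same depth with different upper ends occupy disjoint intervals. -/
theorem lt_of_parent_lt (hf : IsAddress a p d g N f) (hr : G.IsRootedAt a p d) {x y : S}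
    (hx : x ≠ a) (hy : y ≠ a) (hd : d x = d y) (h : f (p x) < f (p y)) :
    f x < f y ∧ f x < f (p y) ∧ f (p x) < f y := by
  have hdx := hr.depth_eq x hx
  have hdy := hr.depth_eq y hy
  obtain ⟨K, hK, h1, h2⟩ := hf.exists_scale hr hx
  obtain ⟨c, hc⟩ := h1 (p x) (by omega)
  obtain ⟨c', hc'⟩ := h1 (p y) (by omega)
  have h3 := h2 x hx rfl
  have h4 := h2 y hy hd.symm
  obtain ⟨hg1, hg2⟩ := abs_le.1 (hf.abs_g_le x hx)
  obtain ⟨hg3, hg4⟩ := abs_le.1 (hf.abs_g_le y hy)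
  have hN : (0 : ℤ) ≤ N := Nat.cast_nonneg N
  rw [hc] at h3
  rw [hc'] at h4
  rw [← mul_lt_mul_iff_left₀ hK, hc, hc'] at h
  rw [← mul_lt_mul_iff_left₀ hK, ← mul_lt_mul_iff_left₀ hK (b := f x) (c := f (p y)),
    ← mul_lt_mul_iff_left₀ hK (b := f (p x)) (c := f y), h3, h4, hc, hc']
  norm_cast at h ⊢
  push_cast at h ⊢
  have h5 : c < c' := by
    by_contra! h6
    nlinarith
  have h6 : c * (2 * N + 1) + (2 * N + 1) ≤ c' * (2 * N + 1) := by nlinarith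
  refine ⟨by omega, by omega, by omega⟩

theorem sibling_lt (hf : IsAddress a p d g N f) (hr : G.IsRootedAt a p d) {x y : S}
    (hx : x ≠ a) (hy : y ≠ a) (hp : p x = p y) (h : g x < g y) : f x < f y := by
  have hdx := hr.depth_eq x hx
  have hdy := hr.depth_eq y hy
  rw [hf.step x hx, hf.step y hy, hp, show d x = d y by rw [hdx, hdy, hp]]
  have h' : (g x : ℚ) < g y := by exact_mod_cast h
  gcongr

theorem parent_lt (hf : IsAddress a p d g N f) {x : S} (hx : x ≠ a) (h : 0 < g x) :
    f (p x) < f x := by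
  rw [hf.step x hx]
  have h' : (0 : ℚ) < g x := by exact_mod_cast h
  have : 0 < (g x : ℚ) / (2 * N + 1) ^ d x := by positivity
  linarith

theorem lt_parent (hf : IsAddress a p d g N f) {x : S} (hx : x ≠ a) (h : g x < 0) :
    f x < f (p x) := by
  rw [hf.step x hx]
  have h' : (g x : ℚ) < 0 := by exact_mod_cast h
  have : (g x : ℚ) / (2 * N + 1) ^ d x < 0 := div_neg_of_neg_of_pos h' (by positivity)
  linarith

/-- A vertex under an edge is at least as deep as the lower end of that edge. For crossing edges
this forces the inner ends `v` and `x` to be the lower ends, at equal depth. Their parents differ,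
so the two edges occupy disjoint intervals. -/
theorem not_crossing (hf : IsAddress a p d g N f) (hr : G.IsRootedAt a p d)
    (hinj : f.Injective) {u v x y : S} (huv : G.Adj u v) (hxy : G.Adj x y)
    (h1 : f u < f x) (h2 : f x < f v) (h3 : f v < f y) : False := by
  have hnb : ∀ c z, c ≠ a → f (p c) < f z ∧ f z < f c ∨ f c < f z ∧ f z < f (p c) → d c ≤ d z := by
    intro c z hc h
    by_contra! hd
    obtain ⟨-, h4, h5⟩ := hf.not_between hr hc hd
    rcases h with ⟨h6, h7⟩ | ⟨h6, h7⟩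
    · exact lt_asymm h7 (h4 h6)
    · exact lt_asymm h6 (h5 h7)
  have hpl : ∀ c c', c ≠ a → c' ≠ a → d c = d c' → p c ≠ p c' →
      (f c < f c' ∧ f c < f (p c') ∧ f (p c) < f c' ∧ f (p c) < f (p c')) ∨
      (f c' < f c ∧ f c' < f (p c) ∧ f (p c') < f c ∧ f (p c') < f (p c)) := by
    intro c c' hc hc' hd hne
    rcases lt_trichotomy (f (p c)) (f (p c')) with h | h | h
    · have := hf.lt_of_parent_lt hr hc hc' hd h
      tauto
    · exact absurd (hinj h) hne
    · have := hf.lt_of_parent_lt hr hc' hc hd.symm h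
      tauto
  rcases hr.eq_parent u v huv with ⟨hc, hp⟩ | ⟨hc, hp⟩ <;>
    rcases hr.eq_parent x y hxy with ⟨hc', hp'⟩ | ⟨hc', hp'⟩
  · have hd1 := hr.depth_eq u hc
    have hd2 := hr.depth_eq x hc'
    rw [hp] at hd1
    have h4 := hnb u x hc (Or.inr ⟨h1, hp ▸ h2⟩)
    have h5 := hnb x v hc' (Or.inr ⟨h2, hp' ▸ h3⟩)
    omega
  · have hd1 := hr.depth_eq u hc
    have hd2 := hr.depth_eq y hc'
    rw [hp] at hd1
    rw [hp'] at hd2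
    have h4 := hnb u x hc (Or.inr ⟨h1, hp ▸ h2⟩)
    have h5 := hnb y v hc' (Or.inl ⟨hp' ▸ h2, h3⟩)
    omega
  · have hd1 := hr.depth_eq v hc
    have hd2 := hr.depth_eq x hc'
    have h4 := hnb v x hc (Or.inl ⟨hp ▸ h1, h2⟩)
    have h5 := hnb x v hc' (Or.inr ⟨h2, hp' ▸ h3⟩)
    have hne : p v ≠ p x := by
      rw [hp, hp']
      rintro rfl
      exact lt_asymm (h1.trans h2) h3
    have := hpl v x hc hc' (by omega) hne
    rw [hp, hp'] at this
    rcases this with h | h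
    · exact lt_asymm h2 h.1
    · exact lt_asymm h1 h.2.1
  · have hd1 := hr.depth_eq v hc
    have hd2 := hr.depth_eq y hc'
    rw [hp'] at hd2
    have h4 := hnb v x hc (Or.inl ⟨hp ▸ h1, h2⟩)
    have h5 := hnb y v hc' (Or.inl ⟨hp' ▸ h2, h3⟩)
    omega

end IsAddress

namespace RibbonGraph

variable {S : Type*} {T : RibbonGraph S} {a b : S} {p : S → S} {d : S → ℕ}

open Classical in
/-- The largest neighbor of `u` in the contour order of the tree with root edge `a b`. -/
noncomputable def firstEdge (T : RibbonGraph S) (a b : S) (p : S → S) (u : S) : S :=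
  if u = a then b else if u ∈ T.black then p u else T.rot u (p u)

theorem adj_firstEdge (hr : T.graph.IsRootedAt a p d) (hab : T.graph.Adj a b) (u : S) :
    T.graph.Adj u (T.firstEdge a b p u) := by
  rw [firstEdge]
  split_ifs with h1 h2
  · exact h1 ▸ hab
  · exact hr.adj_parent u h1
  · exact T.adj_rot_pow (hr.adj_parent u h1) 1

/-- Passes from rational positions to positions in a permutation. -/
theorem IsContourOrder.of_lt_iff {α β : Type*} [LinearOrder α] [LinearOrder β] {f : S → α}
    {f' : S → β} (hf : T.IsContourOrder a b f) (h : ∀ x y, f x < f y ↔ f' x < f' y) :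
    T.IsContourOrder a b f' := by
  have hle : ∀ x y, f x ≤ f y ↔ f' x ≤ f' y := fun x y => by
    rw [← not_lt, ← not_lt, h]
  refine ⟨fun x y hxy => hf.injective (le_antisymm ((hle _ _).2 hxy.le) ((hle _ _).2 hxy.ge)),
    fun v => (hle _ _).1 (hf.root_le v), fun v => (hle _ _).1 (hf.le_last v),
    ⟨fun u v huv hu => (h _ _).1 (hf.isNonCrossing.lt_of_black u v huv hu), ?_⟩, ?_⟩
  · intro u v x y huv hxy h1 h2 h3
    exact hf.isNonCrossing.not_crossing u v x y huv hxy ((h _ _).2 h1) ((h _ _).2 h2)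
      ((h _ _).2 h3)
  · intro u r hur hmax n m hnm hm
    exact (h _ _).1 (hf.rotDesc u r hur (fun z hz => (hle _ _).2 (hmax z hz)) n m hnm hm)

variable [Fintype S]

/-- Here `κ v` is the index of `v` in the rotation at its parent, read from `firstEdge`. The signs
of `g` put black children to the left of their parent and white ones to the right, and `g` decreases
with `κ`, so siblings appear in rotation order. -/
theorem isContourOrder_of_isAddress {g : S → ℤ} {κ : S → ℕ} {N : ℕ} {f : S → ℚ}
    (hf : IsAddress a p d g N f) (hr : T.graph.IsRootedAt a p d) (hab : T.graph.Adj a b)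
    (hbic : ∀ u v, T.graph.Adj u v → (u ∈ T.black ↔ v ∉ T.black)) (ha : a ∈ T.black)
    (hg : ∀ v, v ≠ a → (v ∈ T.black → g v = -(κ v + 1)) ∧ (v ∉ T.black → g v = N - κ v))
    (hκ : ∀ v, v ≠ a → κ v < T.deg (p v) ∧
      (T.rot (p v) ^ κ v) (T.firstEdge a b p (p v)) = v)
    (hN : ∀ v, v ≠ a → κ v < N) : T.IsContourOrder a b f := by
  have hpb : ∀ v, v ≠ a → (v ∈ T.black ↔ p v ∉ T.black) := fun v hv =>
    hbic _ _ (hr.adj_parent v hv)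
  have hba : b ≠ a := hab.ne'
  have hfirst := T.adj_firstEdge hr hab
  have hκeq : ∀ v n, v ≠ a → n < T.deg (p v) →
      (T.rot (p v) ^ n) (T.firstEdge a b p (p v)) = v → κ v = n := by
    intro v n hv hn h
    exact T.rot_pow_injOn (hfirst _) (hκ v hv).1 hn ((hκ v hv).2.trans h.symm)
  have hinj : f.Injective := by
    refine hf.injective hr fun x y hx hy hxy hgxy => ?_
    have h1 : κ x = κ y := by
      by_cases hb : x ∈ T.black
      · have hb' : y ∈ T.black := by rwa [hpb y hy, ← hxy, ← hpb x hx]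
        rw [(hg x hx).1 hb, (hg y hy).1 hb'] at hgxy
        omega
      · have hb' : y ∉ T.black := by rwa [hpb y hy, ← hxy, ← hpb x hx]
        rw [(hg x hx).2 hb, (hg y hy).2 hb'] at hgxy
        omega
    rw [← (hκ x hx).2, ← (hκ y hy).2, hxy, h1]
  have hsib : ∀ x y, x ≠ a → y ≠ a → p x = p y → κ x < κ y → f y < f x := by
    intro x y hx hy hxy h
    refine hf.sibling_lt hr hy hx hxy.symm ?_
    by_cases hb : x ∈ T.black
    · have hb' : y ∈ T.black := by rwa [hpb y hy, ← hxy, ← hpb x hx]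
      rw [(hg x hx).1 hb, (hg y hy).1 hb']
      omega
    · have hb' : y ∉ T.black := by rwa [hpb y hy, ← hxy, ← hpb x hx]
      rw [(hg x hx).2 hb, (hg y hy).2 hb']
      omega
  have hneg : ∀ v, v ≠ a → v ∈ T.black → f v < f (p v) := by
    intro v hv hb
    refine hf.lt_parent hv ?_
    rw [(hg v hv).1 hb]
    omega
  have hpos : ∀ v, v ≠ a → v ∉ T.black → f (p v) < f v := by
    intro v hv hb
    refine hf.parent_lt hv ?_
    rw [(hg v hv).2 hb]
    have := hN v hv
    omega
  have hnc : T.IsNonCrossing f := by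
    refine ⟨fun u v huv hu => ?_, fun u v x y => hf.not_crossing hr hinj⟩
    rcases hr.eq_parent u v huv with ⟨h1, rfl⟩ | ⟨h1, rfl⟩
    · exact hneg u h1 hu
    · exact hpos v h1 ((hbic _ _ huv).1 hu)
  have hroot : ∀ v, f a ≤ f v := by
    intro v
    induction hn : d v generalizing v with
    | zero =>
      by_cases hv : v = a
      · rw [hv]
      · have := hr.depth_eq v hv
        omega
    | succ n ih =>
      by_cases hv : v = a
      · rw [hv]
      have hd := hr.depth_eq v hv
      rcases (ih (p v) (by omega)).eq_or_lt with h | h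
      · have h1 := hinj h
        rw [h1]
        exact (hpos v hv (by rw [hpb v hv, ← h1]; simpa)).le
      · exact ((hf.not_between hr hv (by rw [hr.depth_root]; omega)).2.2 h).le
  have hpba : p b = a := by
    rcases hr.eq_parent a b hab with h | h
    · exact absurd rfl h.1
    · exact h.2
  have hfa : T.firstEdge a b p a = b := if_pos rfl
  have hκb : κ b = 0 :=
    hκeq b 0 hba (T.deg_pos (hr.adj_parent b hba).symm) (by rw [hpba, hfa]; rfl)
  -- Siblings of `b` have larger index and children of `b` are black. For any other vertex deeper
  -- than `b`, `b` is not between it and its parent, so induction applies.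
  have hlast : ∀ v, v ≠ b → f v < f b := by
    have hdb := hr.depth_eq b hba
    rw [hpba, hr.depth_root] at hdb
    intro v
    induction hn : d v generalizing v with
    | zero =>
      intro _
      by_cases hv : v = a
      · rw [hv]
        exact hnc.lt_of_black _ _ hab ha
      · have := hr.depth_eq v hv
        omega
    | succ n ih =>
      intro hvb
      by_cases hv : v = a
      · rw [hv]
        exact hnc.lt_of_black _ _ hab ha
      have hd := hr.depth_eq v hv
      by_cases h1 : p v = a
      · refine hsib b v hba hv (hpba.trans h1.symm) ?_
        rw [hκb, Nat.pos_iff_ne_zero]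
        intro h0
        have h2 := (hκ v hv).2
        rw [h0, h1, hfa] at h2
        exact hvb h2.symm
      by_cases h2 : p v = b
      · have h3 : v ∈ T.black := by rw [hpb v hv, h2]; exact (hbic _ _ hab).1 ha
        have := hneg v hv h3
        rwa [h2] at this
      have hd' := hr.depth_eq (p v) h1
      obtain ⟨h3, h4, -⟩ := hf.not_between hr hv (z := b) (by omega)
      exact h4 (ih (p v) (by omega) h2)
  refine ⟨hinj, hroot, fun v => ?_, hnc, ?_⟩
  · by_cases hv : v = b
    · rw [hv]
    · exact (hlast v hv).le
  intro u r hur hmax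
  have hadj := hfirst u
  have key : ∀ n m, n < m → m < T.deg u →
      f ((T.rot u ^ m) (T.firstEdge a b p u)) < f ((T.rot u ^ n) (T.firstEdge a b p u)) := by
    intro n m hnm hm
    have hadjn := T.adj_rot_pow hadj n
    have hadjm := T.adj_rot_pow hadj m
    have hne : (T.rot u ^ m) (T.firstEdge a b p u) ≠ (T.rot u ^ n) (T.firstEdge a b p u) :=
      fun h => hnm.ne' (T.rot_pow_injOn hadj hm (hnm.trans hm) h)
    have hchild : ∀ z, T.graph.Adj u z → (u = a ∨ p u ≠ z) → z ≠ a ∧ p z = u := by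
      intro z hz h
      rcases hr.eq_parent u z hz with h1 | h1
      · exact absurd h1.2 (h.resolve_left h1.1)
      · exact h1
    have hchildren : (u = a ∨ p u ≠ (T.rot u ^ n) (T.firstEdge a b p u)) →
        (u = a ∨ p u ≠ (T.rot u ^ m) (T.firstEdge a b p u)) →
        f ((T.rot u ^ m) (T.firstEdge a b p u)) < f ((T.rot u ^ n) (T.firstEdge a b p u)) := by
      intro h1 h2
      obtain ⟨h3, h4⟩ := hchild _ hadjn h1
      obtain ⟨h5, h6⟩ := hchild _ hadjm h2
      refine hsib _ _ h3 h5 (h4.trans h6.symm) ?_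
      rw [hκeq _ n h3 (h4.symm ▸ hnm.trans hm) (by rw [h4]),
        hκeq _ m h5 (h6.symm ▸ hm) (by rw [h6])]
      exact hnm
    by_cases hu : u = a
    · exact hchildren (Or.inl hu) (Or.inl hu)
    by_cases h1 : p u = (T.rot u ^ n) (T.firstEdge a b p u)
    · by_cases hb : u ∈ T.black
      · refine lt_of_le_of_ne ?_ fun h => hne (hinj h)
        rw [← h1]
        exact hnc.le_parent hinj hroot hr hu hb hadjm
      -- At a white vertex `firstEdge` is the successor of the parent, so the parent has the last
      -- index and cannot precede another neighbor.
      · exfalso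
        have h2 : (T.rot u ^ (n + 1)) (T.firstEdge a b p u) = (T.rot u ^ 0)
            (T.firstEdge a b p u) := by
          rw [pow_succ', Equiv.Perm.mul_apply, ← h1, pow_zero, Equiv.Perm.one_apply, firstEdge,
            if_neg hu, if_neg hb]
        have := T.rot_pow_injOn hadj (by omega) (by omega) h2
        omega
    by_cases h2 : p u = (T.rot u ^ m) (T.firstEdge a b p u)
    · by_cases hb : u ∈ T.black
      · exfalso
        have h3 : (T.rot u ^ m) (T.firstEdge a b p u) = (T.rot u ^ 0)
            (T.firstEdge a b p u) := by
          rw [← h2, pow_zero, Equiv.Perm.one_apply, firstEdge, if_neg hu, if_pos hb]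
        have := T.rot_pow_injOn hadj hm (by omega) h3
        omega
      · refine lt_of_le_of_ne ?_ fun h => hne (hinj h)
        rw [← h2]
        refine hnc.parent_le hinj hroot hr hu ?_ hadjn
        by_contra h
        exact hb ((hpb u hu).2 h)
    · exact hchildren (Or.inr h1) (Or.inr h2)
  have hrf : r = T.firstEdge a b p u := by
    obtain ⟨k, hk, rfl⟩ := T.exists_rot_pow_eq hadj hur
    rcases Nat.eq_zero_or_pos k with rfl | h0
    · rfl
    · exact absurd (hmax _ hadj) (not_le.2 (key 0 k h0 hk))
  rw [hrf]
  exact key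

/-- Every rooted plane tree has a contour order. -/
theorem exists_isContourOrder (hG : T.graph.IsTree) (hab : T.graph.Adj a b)
    (hbic : ∀ u v, T.graph.Adj u v → (u ∈ T.black ↔ v ∉ T.black)) (ha : a ∈ T.black) :
    ∃ f : S → ℚ, T.IsContourOrder a b f := by
  classical
  obtain ⟨p, d, hr⟩ := hG.exists_isRootedAt a
  have hex : ∀ v, ∃ n, v ≠ a → n < T.deg (p v) ∧
      (T.rot (p v) ^ n) (T.firstEdge a b p (p v)) = v := by
    intro v
    by_cases hv : v = a
    · exact ⟨0, fun h => absurd hv h⟩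
    · obtain ⟨n, hn⟩ := T.exists_rot_pow_eq (T.adj_firstEdge hr hab (p v))
        (hr.adj_parent v hv).symm
      exact ⟨n, fun _ => hn⟩
  choose κ hκ using hex
  have hN : ∀ v, v ≠ a → κ v < Fintype.card S := fun v hv =>
    (hκ v hv).1.trans_le (T.deg_le _)
  let g : S → ℤ := fun v =>
    if v ∈ T.black then -((κ v : ℤ) + 1) else (Fintype.card S : ℤ) - κ v
  obtain ⟨f, hf⟩ := IsAddress.exists_of_isRootedAt (g := g) (N := Fintype.card S) hr
    (fun v hv => by
      have := hN v hv
      simp only [g]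
      split_ifs <;> omega)
    (fun v hv => by
      have := hN v hv
      simp only [g]
      rw [abs_le]
      split_ifs <;> constructor <;> omega)
  exact ⟨f, isContourOrder_of_isAddress hf hr hab hbic ha
    (fun v hv => ⟨fun hb => if_pos hb, fun hb => if_neg hb⟩) hκ hN⟩

end RibbonGraph

/-! ### The bijection and the count of trees -/

namespace FullPassport

variable {S : Type*} [Fintype S]

theorem bijOn_comb [Nonempty S] (Ξ : FullPassport S) :
    Set.BijOn Ξ.comb Ξ.PositiveTreePerm Ξ.RootedTree := by
  refine ⟨fun P hP => comb_mem_rootedTree hP, Ξ.injOn_comb, ?_⟩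
  rintro ⟨T, a, b⟩ ⟨hT, hab, ha, -⟩
  obtain ⟨f, hf⟩ := RibbonGraph.exists_isContourOrder hT.isTree hab hT.bicolored ha
  -- The permutation lists the vertices by increasing address.
  let o : LinearOrder S := LinearOrder.lift' f hf.injective
  let P : Permutation S := (Fintype.orderIsoFinOfCardEq S rfl).toEquiv
  have hlt : ∀ x y, f x < f y ↔ P.symm x < P.symm y := fun x y =>
    ((Fintype.orderIsoFinOfCardEq S rfl).symm.lt_iff_lt (x := x) (y := y)).symm
  have hP := hf.of_lt_iff hlt
  have h0 : P ⟨0, Fintype.card_pos⟩ = a := by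
    refine P.eq_symm_apply.1 (le_antisymm (Nat.zero_le _) ?_)
    have := hP.root_le (P ⟨0, Fintype.card_pos⟩)
    rwa [Equiv.symm_apply_apply] at this
  have h1 : P ⟨Fintype.card S - 1, Nat.sub_lt Fintype.card_pos Nat.one_pos⟩ = b := by
    refine P.eq_symm_apply.1
      (le_antisymm ?_ (Nat.le_sub_one_of_lt (P.symm b).isLt))
    have := hP.le_last (P ⟨Fintype.card S - 1, Nat.sub_lt Fintype.card_pos Nat.one_pos⟩)
    rwa [Equiv.symm_apply_apply] at this
  exact ⟨P, hT.comb_eq hP.isNonCrossing hP.rotDesc hab h0 h1⟩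

theorem IsPlaneTree.exists_root [Nonempty S] {Ξ : FullPassport S} {T : RibbonGraph S}
    (hT : Ξ.IsPlaneTree T) : ∃ a b, (T, a, b) ∈ Ξ.RootedTree := by
  have h1 := hT.ncard_edgeSet
  have h2 := Ξ.two_le_card
  obtain ⟨e, he⟩ := Set.nonempty_of_ncard_ne_zero (s := T.graph.edgeSet) (by omega)
  induction e with | _ u v
  have he : T.graph.Adj u v := he
  by_cases hu : u ∈ T.black
  · exact ⟨u, v, hT, he, hu, (hT.bicolored _ _ he).1 hu⟩
  · refine ⟨v, u, hT, he.symm, ?_, hu⟩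
    by_contra hv
    exact hu ((hT.bicolored _ _ he).2 hv)

/-- A plane tree has as many roots as edges. -/
theorem IsPlaneTree.ncard_roots {Ξ : FullPassport S} {T : RibbonGraph S}
    (hT : Ξ.IsPlaneTree T) :
    {x ∈ Ξ.RootedTree | x.1 = T}.ncard = Fintype.card S - 1 := by
  rw [← hT.ncard_edgeSet, Nat.add_sub_cancel]
  refine Set.ncard_congr (fun x _ => s(x.2.1, x.2.2)) ?_ ?_ ?_
  · rintro ⟨T', a, b⟩ ⟨⟨-, hab, -⟩, rfl⟩
    exact hab
  · rintro ⟨T', a, b⟩ ⟨T'', a', b'⟩ ⟨⟨-, -, ha, hb⟩, rfl⟩ ⟨⟨-, -, ha', hb'⟩, h⟩ he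
    obtain rfl : T'' = T' := h
    rcases Sym2.eq_iff.1 he with ⟨h1, h2⟩ | ⟨h1, h2⟩
    · exact Prod.ext rfl (Prod.ext h1 h2)
    · have h1 : a = b' := h1
      subst h1
      exact absurd ha hb'
  · intro e he
    induction e with | _ u v
    have he : T.graph.Adj u v := he
    by_cases hu : u ∈ T.black
    · exact ⟨(T, u, v), ⟨⟨hT, he, hu, (hT.bicolored _ _ he).1 hu⟩, rfl⟩, rfl⟩
    · have hv : v ∈ T.black := by
        by_contra hv
        exact hu ((hT.bicolored _ _ he).2 hv)
      exact ⟨(T, v, u), ⟨⟨hT, he.symm, hv, hu⟩, rfl⟩, Sym2.eq_swap⟩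

theorem finite_rootedTree [Nonempty S] (Ξ : FullPassport S) : Ξ.RootedTree.Finite := by
  rw [← Ξ.bijOn_comb.image_eq]
  exact (Set.toFinite _).image _

theorem image_fst_rootedTree [Nonempty S] (Ξ : FullPassport S) :
    Prod.fst '' Ξ.RootedTree = Ξ.Tree := by
  ext T
  constructor
  · rintro ⟨x, hx, rfl⟩
    exact hx.1
  · intro hT
    obtain ⟨a, b, h⟩ := hT.exists_root
    exact ⟨_, h, rfl⟩

theorem finite_tree [Nonempty S] (Ξ : FullPassport S) : Ξ.Tree.Finite := by
  rw [← Ξ.image_fst_rootedTree]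
  exact Ξ.finite_rootedTree.image _

theorem ncard_rootedTree [Nonempty S] (Ξ : FullPassport S) :
    Ξ.RootedTree.ncard = (Fintype.card S - 1) * Ξ.Tree.ncard := by
  classical
  rw [Set.ncard_eq_toFinset_card _ Ξ.finite_rootedTree, Set.ncard_eq_toFinset_card _ Ξ.finite_tree,
    mul_comm]
  rw [Finset.card_eq_sum_card_fiberwise (f := Prod.fst) (t := Ξ.finite_tree.toFinset)]
  · refine Finset.sum_const_nat fun T hT => ?_
    rw [← IsPlaneTree.ncard_roots ((Set.Finite.mem_toFinset _).1 hT), ← Set.ncard_coe_finset]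
    congr 1
    ext x
    simp
  · intro x hx
    exact Finset.mem_coe.2 ((Set.Finite.mem_toFinset _).2 ((Set.Finite.mem_toFinset _).1 hx).1)

end FullPassport

theorem proposition3p3 {S : Type*} [Fintype S] [Nonempty S] (Ξ : FullPassport S) :
    Set.BijOn Ξ.comb Ξ.PositiveTreePerm Ξ.RootedTree ∧
      Ξ.Tree.Finite ∧
      Ξ.PositiveTreePerm.ncard = (Fintype.card S - 1) * Ξ.Tree.ncard := by
  refine ⟨Ξ.bijOn_comb, Ξ.finite_tree, ?_⟩
  rw [← Ξ.ncard_rootedTree, ← Ξ.bijOn_comb.image_eq, Ξ.bijOn_comb.injOn.ncard_image]
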